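/- **Words.** Let $W=W[0]W[1]W[2]\dots$ be a right-infinite word over a finite alphabet. A finite word is a *subword* of $W$ if it occurs in $W$ as a block of consecutive letters. $W$ is *recurrent* if every subword occurs in $W$ infinitely often, and *periodic* if for some $k\ge 1$ one has $W[i+k]=W[i]$ for all $i$. For finite words write $u\sqsubseteq_k t$ if $u$ has at least $k$ occurrences in $t$, and $u\sqsubseteq t$ for $u\sqsubseteq_1 t$. **Graphs with words.** A *graph with words* is a finite connected directed graph (loops and parallel edges are allowed) in which every edge $e$ carries two finite words, a front word $F(e)$ and a back word $B(e)$, and in which every vertex is either *distributing* (in-degree $1$, out-degree $>1$) or *collecting* (in-degree $>1$, out-degree $1$). A path is a nonempty sequence of consecutive edges. It is *symmetric* if its first edge starts in a collecting vertex and its last edge ends in a distributing vertex. For a path $p=e_1\dots e_n$, $F(p)$ is the concatenation, in order, of the front words of $e_1$ and of those $e_i$, $i\ge2$, that leave distributing vertices; $B(p)$ is the concatenation, in order, of the back words of those $e_i$, $i<n$, that enter collecting vertices and of $e_n$. For paths, $\sqsubseteq_k$ refers to their sequences of edges as words. **Rauzy schemes.** A graph with words $S$ is a *Rauzy scheme*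 for $W$ if: 1. $S$ is strongly connected and has more than one edge. 2. The edges leaving any one distributing vertex have front words with pairwise distinct first letters (in particular, nonempty), and the edges entering any one collecting vertex have back words with pairwise distinct last letters (in particular, nonempty). 3. $F(p)=B(p)$ for every symmetric path $p$. 4. If $p,q$ are symmetric paths, $k$ is a natural number and $F(p)\sqsubseteq_k F(q)$, then $p\sqsubseteq_k q$. 5. All front and back words of edges are subwords of $W$. 6. For every subword $u$ of $W$ there is a symmetric path $p$ with $u\sqsubseteq F(p)$. 7. For every edge $e$ there is a subword $u_e$ of $W$ such that every symmetric path $p$ with $u_e\sqsubseteq F(p)$ passes through $e$. **Elementary evolution.** Let $S$ be a Rauzy scheme for $W$ and let $v$ be a *support edge*, i.e. an edge from a collecting vertex to a distributing vertex. Let $\{x_i\}$ be the edges entering the beginning of $v$ and $\{y_j\}$ the edges leaving the end of $v$ (an edge may belong to both sets), and put $V=F(v)$, $X_i=B(x_i)$, $Y_j=F(y_j)$. The graph $S'$ is obtained from $S$ by deleting $v$, replacing its beginning by vertices $A_i$, one for each $x_i$, so that $x_i$ now ends in $A_i$, replacing its end by vertices $B_j$, one for each $y_j$, so that $y_j$ now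 starts in $B_j$, and adding an edge $v_{ij}$ from $A_i$ to $B_j$ for all $i,j$. In $S'$ the front word of $y_j$ is $VY_j$, the front word of $v_{ij}$ is $Y_j$, the back word of $x_i$ is $X_iV$, the back word of $v_{ij}$ is $X_i$, and all other front and back words are those in $S$. The edge $v_{ij}$ is *bad* if $X_iVY_j$ is not a subword of $W$; all other edges of $S'$ are *good*. A vertex of $S'$ is *non-vanishing* if more than one good edge leaves it or more than one good edge enters it. The vertices of the graph $S''$ are the non-vanishing vertices of $S'$; its edges are the paths in $S'$ along good edges that start and end in non-vanishing vertices and have no non-vanishing intermediate vertices. The natural extension of an edge $e$ of $S''$ to the right (left) is the shortest path in $S''$ that begins with $e$ and ends in a distributing vertex of $S''$ (that ends with $e$ and starts in a collecting vertex of $S''$). The front (back) word of $e$ in $S''$ is the front (back) word in $S'$ of the path of $S'$ that corresponds to the natural extension of $e$ to the right (left). The graph with words $S''$ is the *elementary evolution* $(W,S,v)$. **Theorem.** Let $W$ be a recurrent non-periodic right-infinite word over a finite alphabet, $S$ a Rauzy scheme for $W$ and $v$ a support edge of $S$. Then every edge of $S''$ has a unique natural extension to the right and a unique natural extension to the left (so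 the elementary evolution is well defined), and the elementary evolution $(W,S,v)$ is a graph with words and a Rauzy scheme for $W$, that is, it has properties 1–7. -/

import Mathlib

universe u w

namespace RauzyEvolution

/-! ### Finite words and one-sided infinite words -/

/-- The word `u` occurs in the infinite word `W` at position `i`. -/
def OccursAt {α : Type w} (u : List α) (W : ℕ → α) (i : ℕ) : Prop :=
  ∀ (j : ℕ) (h : j < u.length), u[j] = W (i + j)

/-- The finite word `u` is a subword of the infinite word `W`. -/
def IsSubword {α : Type w} (u : List α) (W : ℕ → α) : Prop :=
  ∃ i, OccursAt u W i

/-- Every subword of `W` occurs in `W` infinitely many times. -/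
def IsRecurrent {α : Type w} (W : ℕ → α) : Prop :=
  ∀ u : List α, IsSubword u W → {i | OccursAt u W i}.Infinite

/-- `W` has a positive period. -/
def IsPeriodic {α : Type w} (W : ℕ → α) : Prop :=
  ∃ k, 0 < k ∧ ∀ i, W (i + k) = W i

/-- The finite word `u` occurs in the finite word `t` at least `k` times; an occurrence is a
factorization `t = p ++ u ++ q`. -/
def OccursAtLeast {β : Type w} (k : ℕ) (u t : List β) : Prop :=
  (k : ℕ∞) ≤ {d : List β × List β | d.1 ++ u ++ d.2 = t}.encard

/-! ### Directed multigraphs and paths -/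

/-- A directed graph; loops and parallel edges are allowed. -/
structure MultiDigraph where
  Vert : Type u
  Edge : Type u
  src : Edge → Vert
  tgt : Edge → Vert

namespace MultiDigraph

variable (G : MultiDigraph.{u})

/-- A distributing vertex: in-degree one, out-degree greater than one. -/
def IsDistributing (x : G.Vert) : Prop :=
  {e | G.tgt e = x}.encard = 1 ∧ 1 < {e | G.src e = x}.encard

/-- A collecting vertex: in-degree greater than one, out-degree one. -/
def IsCollecting (x : G.Vert) : Prop :=
  1 < {e | G.tgt e = x}.encard ∧ {e | G.src e = x}.encard = 1

/-- There is an edge from `x` to `y`. -/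
def Step (x y : G.Vert) : Prop := ∃ e, G.src e = x ∧ G.tgt e = y

/-- Connected (disregarding the orientation), and nonempty. -/
def IsConnected : Prop :=
  Nonempty G.Vert ∧ ∀ x y, Relation.EqvGen G.Step x y

/-- Every vertex can be reached from every vertex along directed edges. -/
def IsStronglyConnected : Prop :=
  ∀ x y, Relation.ReflTransGen G.Step x y

/-- A path, given by its (nonempty) sequence of consecutive edges. -/
def IsPath (p : List G.Edge) : Prop :=
  p ≠ [] ∧ p.IsChain (fun e f => G.tgt e = G.src f)

/-- The first edge of `p` starts in a collecting vertex. -/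
def StartsCollecting (p : List G.Edge) : Prop :=
  ∃ e ∈ p.head?, G.IsCollecting (G.src e)

/-- The last edge of `p` ends in a distributing vertex. -/
def EndsDistributing (p : List G.Edge) : Prop :=
  ∃ e ∈ p.getLast?, G.IsDistributing (G.tgt e)

/-- A symmetric path starts in a collecting vertex and ends in a distributing one. -/
def IsSymmetricPath (p : List G.Edge) : Prop :=
  G.IsPath p ∧ G.StartsCollecting p ∧ G.EndsDistributing p

/-- `p` is the natural extension of the path `s` to the right: a minimal path that begins with
`s` and ends in a distributing vertex. -/
def IsRightExtension (s p : List G.Edge) : Prop :=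
  (G.IsPath p ∧ s <+: p ∧ G.EndsDistributing p) ∧
    ∀ q, G.IsPath q → s <+: q → G.EndsDistributing q → p.length ≤ q.length

/-- `p` is the natural extension of the path `s` to the left: a minimal path that ends with
`s` and starts in a collecting vertex. -/
def IsLeftExtension (s p : List G.Edge) : Prop :=
  (G.IsPath p ∧ s <:+ p ∧ G.StartsCollecting p) ∧
    ∀ q, G.IsPath q → s <:+ q → G.StartsCollecting q → p.length ≤ q.length

open Classical in
/-- The natural extension of an edge to the right (with a dummy value if there is none). -/
noncomputable def rightExtension (e : G.Edge) : List G.Edge :=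
  if h : ∃ p, G.IsRightExtension [e] p then h.choose else [e]

open Classical in
/-- The natural extension of an edge to the left (with a dummy value if there is none). -/
noncomputable def leftExtension (e : G.Edge) : List G.Edge :=
  if h : ∃ p, G.IsLeftExtension [e] p then h.choose else [e]

/-- A support edge goes from a collecting vertex to a distributing vertex. -/
def IsSupportEdge (v : G.Edge) : Prop :=
  G.IsCollecting (G.src v) ∧ G.IsDistributing (G.tgt v)

variable {G}

theorem IsSupportEdge.src_ne {v : G.Edge} (hv : G.IsSupportEdge v) {e : G.Edge} (he : e ≠ v) :
    G.src e ≠ G.src v := by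
  intro h
  obtain ⟨a, ha⟩ := Set.encard_eq_one.1 hv.1.2
  have h1 : e ∈ {f | G.src f = G.src v} := h
  have h2 : v ∈ {f | G.src f = G.src v} := rfl
  rw [ha, Set.mem_singleton_iff] at h1 h2
  exact he (h1.trans h2.symm)

theorem IsSupportEdge.tgt_ne {v : G.Edge} (hv : G.IsSupportEdge v) {e : G.Edge} (he : e ≠ v) :
    G.tgt e ≠ G.tgt v := by
  intro h
  obtain ⟨a, ha⟩ := Set.encard_eq_one.1 hv.2.1
  have h1 : e ∈ {f | G.tgt f = G.tgt v} := h
  have h2 : v ∈ {f | G.tgt f = G.tgt v} := rfl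
  rw [ha, Set.mem_singleton_iff] at h1 h2
  exact he (h1.trans h2.symm)

end MultiDigraph

/-! ### Graphs with words and Rauzy schemes -/

/-- A directed graph with two words on every edge, a front word and a back word. -/
structure WordGraph (α : Type w) extends MultiDigraph.{u} where
  front : Edge → List α
  back : Edge → List α

namespace WordGraph

variable {α : Type w} (S : WordGraph.{u, w} α)

open Classical in
/-- The front word `F(p)` of a path: the front words of its first edge and of all its later edges
that leave distributing vertices, concatenated in order. -/
noncomputable def frontWord : List S.Edge → List α
  | [] => []
  | e :: p => S.front e ++
      (p.filter (fun f => S.IsDistributing (S.src f))).flatMap S.front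

open Classical in
/-- The back word `B(p)` of a path: the back words of all its edges before the last one that enter
collecting vertices, and of its last edge, concatenated in order. -/
noncomputable def backWord (p : List S.Edge) : List α :=
  match p.getLast? with
  | none => []
  | some e =>
      (p.dropLast.filter (fun f => S.IsCollecting (S.tgt f))).flatMap S.back ++ S.back e

/-- A graph with words: a finite connected directed graph, with a front and a back word on
every edge, all of whose vertices are distributing or collecting. -/
structure IsGraphWithWords : Prop where
  finite_vert : Finite S.Vert
  finite_edge : Finite S.Edge
  connected : S.IsConnected
  vert_type : ∀ x, S.IsDistributing x ∨ S.IsCollecting x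

/-- The graph with words `S` is a Rauzy scheme for the infinite word `W`. -/
structure IsRauzyScheme (W : ℕ → α) : Prop extends S.IsGraphWithWords where
  /-- Property 1. -/
  strongly_connected : S.IsStronglyConnected
  more_than_one_edge : Nontrivial S.Edge
  /-- Property 2: the edges leaving a distributing vertex have front words with pairwise distinct
  first letters (in particular these words are nonempty). -/
  front_ne_nil : ∀ e, S.IsDistributing (S.src e) → S.front e ≠ []
  front_head_inj : ∀ e f, S.IsDistributing (S.src e) → S.src e = S.src f →
    (S.front e).head? = (S.front f).head? → e = f
  /-- Property 2: the edges entering a collecting vertex have back words with pairwise distinct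
  last letters (in particular these words are nonempty). -/
  back_ne_nil : ∀ e, S.IsCollecting (S.tgt e) → S.back e ≠ []
  back_last_inj : ∀ e f, S.IsCollecting (S.tgt e) → S.tgt e = S.tgt f →
    (S.back e).getLast? = (S.back f).getLast? → e = f
  /-- Property 3. -/
  front_eq_back : ∀ p, S.IsSymmetricPath p → S.frontWord p = S.backWord p
  /-- Property 4. -/
  path_occurs : ∀ p q, S.IsSymmetricPath p → S.IsSymmetricPath q → ∀ k : ℕ,
    OccursAtLeast k (S.frontWord p) (S.frontWord q) → OccursAtLeast k p q
  /-- Property 5. -/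
  front_subword : ∀ e, IsSubword (S.front e) W
  back_subword : ∀ e, IsSubword (S.back e) W
  /-- Property 6. -/
  subword_covered : ∀ u, IsSubword u W → ∃ p, S.IsSymmetricPath p ∧ u <:+: S.frontWord p
  /-- Property 7. -/
  edge_forced : ∀ e, ∃ u, IsSubword u W ∧
    ∀ p, S.IsSymmetricPath p → u <:+: S.frontWord p → e ∈ p

/-! ### The elementary evolution -/

/-- The edges `x_i` entering the beginning of `v`. -/
abbrev InEdge (v : S.Edge) : Type u := {e : S.Edge // S.tgt e = S.src v}

/-- The edges `y_j` leaving the end of `v`. -/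
abbrev OutEdge (v : S.Edge) : Type u := {e : S.Edge // S.src e = S.tgt v}

open Classical in
/-- The graph with words `S'`: the support edge `v` is replaced by a complete bipartite graph.
The vertices are the vertices of `S` other than the ends of `v`, a vertex `A_i` for every edge
`x_i` and a vertex `B_j` for every edge `y_j`. The edges are the edges of `S` other than `v` (where
`x_i` now ends in `A_i` and `y_j` now starts in `B_j`) and an edge `v_{ij}` from `A_i` to `B_j` for
all `i`, `j`. -/
noncomputable def split (v : S.Edge) (hv : S.IsSupportEdge v) : WordGraph.{u, w} α where
  Vert := {x : S.Vert // x ≠ S.src v ∧ x ≠ S.tgt v} ⊕ (S.InEdge v ⊕ S.OutEdge v)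
  Edge := {e : S.Edge // e ≠ v} ⊕ (S.InEdge v × S.OutEdge v)
  src
    | .inl e =>
        if h : S.src e.1 = S.tgt v then .inr (.inr ⟨e.1, h⟩)
        else .inl ⟨S.src e.1, hv.src_ne e.2, h⟩
    | .inr (x, _) => .inr (.inl x)
  tgt
    | .inl e =>
        if h : S.tgt e.1 = S.src v then .inr (.inl ⟨e.1, h⟩)
        else .inl ⟨S.tgt e.1, h, hv.tgt_ne e.2⟩
    | .inr (_, y) => .inr (.inr y)
  front
    | .inl e => if S.src e.1 = S.tgt v then S.front v ++ S.front e.1 else S.front e.1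
    | .inr (_, y) => S.front y.1
  back
    | .inl e => if S.tgt e.1 = S.src v then S.back e.1 ++ S.front v else S.back e.1
    | .inr (x, _) => S.back x.1

/-- An edge of `S'` is bad if it is an edge `v_{ij}` such that `X_i V Y_j` is not a subword of `W`,
where `X_i` is the back word of `x_i`, `V` the word of `v` and `Y_j` the front word of `y_j`;
all other edges are good. -/
def IsGood (W : ℕ → α) (v : S.Edge) (hv : S.IsSupportEdge v) : (S.split v hv).Edge → Prop
  | .inl _ => True
  | .inr (x, y) => IsSubword (S.back x.1 ++ S.front v ++ S.front y.1) W

end WordGraph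

namespace MultiDigraph

variable (H : MultiDigraph.{u}) (good : H.Edge → Prop)

/-- A vertex is non-vanishing if more than one good edge leaves it or more than one good edge
enters it. -/
def IsNonvanishing (x : H.Vert) : Prop :=
  1 < {e | good e ∧ H.src e = x}.encard ∨ 1 < {e | good e ∧ H.tgt e = x}.encard

/-- The paths along good edges that start and end in non-vanishing vertices and have no
non-vanishing intermediate vertices. -/
structure GoodChain where
  path : List H.Edge
  isPath : H.IsPath path
  good_of_mem : ∀ e ∈ path, good e
  start_nonvanishing : H.IsNonvanishing good (H.src (path.head isPath.1))
  end_nonvanishing : H.IsNonvanishing good (H.tgt (path.getLast isPath.1))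
  inner_vanishing : ∀ e ∈ path.dropLast, ¬ H.IsNonvanishing good (H.tgt e)

/-- The graph whose vertices are the non-vanishing vertices and whose edges are the above
paths. -/
def contract : MultiDigraph.{u} where
  Vert := {x : H.Vert // H.IsNonvanishing good x}
  Edge := H.GoodChain good
  src c := ⟨_, c.start_nonvanishing⟩
  tgt c := ⟨_, c.end_nonvanishing⟩

end MultiDigraph

namespace WordGraph

variable {α : Type w} (S : WordGraph.{u, w} α)

/-- The directed graph underlying the elementary evolution. -/
noncomputable def evolutionGraph (W : ℕ → α) (v : S.Edge) (hv : S.IsSupportEdge v) :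
    MultiDigraph.{u} :=
  (S.split v hv).contract (S.IsGood W v hv)

/-- The path of `S'` that corresponds to a path of the elementary evolution. -/
def expand {W : ℕ → α} {v : S.Edge} {hv : S.IsSupportEdge v}
    (p : List (S.evolutionGraph W v hv).Edge) : List (S.split v hv).Edge :=
  p.flatMap MultiDigraph.GoodChain.path

/-- The elementary evolution `(W, S, v)`. The front (back) word of an edge is the front (back)
word of the path of `S'` that corresponds to the natural extension of the edge to the right
(left). -/
noncomputable def evolution (W : ℕ → α) (v : S.Edge) (hv : S.IsSupportEdge v) :
    WordGraph.{u, w} α where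
  toMultiDigraph := S.evolutionGraph W v hv
  front e := (S.split v hv).frontWord (S.expand ((S.evolutionGraph W v hv).rightExtension e))
  back e := (S.split v hv).backWord (S.expand ((S.evolutionGraph W v hv).leftExtension e))

end WordGraph

end RauzyEvolution

/-!
Reversing all edges and all words exchanges front and back words, and distributing and collecting
vertices, so every argument about one side yields the other.

Counting in property 4 pins down positions: an occurrence of `F(p)` in `F(q)` starts exactly where
an occurrence of `p` in `q` does. A symmetric path of `S'` turns into a symmetric path of `S` with
the same word when its edges `v_{ij}` are read as `v` and, if necessary, `v` is added at its ends;
hence properties 3, 4 and 6 pass from `S` to `S'`, and so does property 7 for the good edges.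
A word of a symmetric path which is a subword of `W` is read along good edges only, so recurrence
joins any two good edges within a good symmetric path whose word is a subword of `W`.

If all vertices of `S'` vanished, a good edge would determine all its successors: reading `W` on
from a recurring symmetric path would be forced, and `W` would be periodic. Hence there is a
non-vanishing vertex, and by counting good edges there are non-vanishing vertices of both types.
Contracting `S'` along the vanishing vertices keeps the words of symmetric paths.
-/

namespace RauzyEvolution

namespace MultiDigraph

variable {G : MultiDigraph.{u}}

/-- A possibly empty path: a list of edges, each of which starts where its predecessor ends. -/
abbrev Linked (G : MultiDigraph.{u}) (p : List G.Edge) : Prop :=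
  p.IsChain (fun e f => G.tgt e = G.src f)

theorem Linked.left {a b : List G.Edge} (h : G.Linked (a ++ b)) : G.Linked a :=
  (List.isChain_append.1 h).1

theorem Linked.right {a b : List G.Edge} (h : G.Linked (a ++ b)) : G.Linked b :=
  (List.isChain_append.1 h).2.1

theorem Linked.tail {e : G.Edge} {b : List G.Edge} (h : G.Linked (e :: b)) : G.Linked b :=
  (List.isChain_cons.1 h).2

theorem Linked.tgt_eq_src {a b : List G.Edge} {e f : G.Edge}
    (h : G.Linked (a ++ e :: f :: b)) : G.tgt e = G.src f :=
  (List.isChain_cons_cons.1 h.right).1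

@[simp] theorem startsCollecting_cons {e : G.Edge} {p : List G.Edge} :
    G.StartsCollecting (e :: p) ↔ G.IsCollecting (G.src e) := by
  simp [StartsCollecting]

@[simp] theorem endsDistributing_concat {e : G.Edge} {p : List G.Edge} :
    G.EndsDistributing (p ++ [e]) ↔ G.IsDistributing (G.tgt e) := by
  simp [EndsDistributing]

@[simp] theorem endsDistributing_singleton {e : G.Edge} :
    G.EndsDistributing [e] ↔ G.IsDistributing (G.tgt e) := by
  simp [EndsDistributing]

@[simp] theorem not_startsCollecting_nil : ¬ G.StartsCollecting [] := by
  simp [StartsCollecting]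

@[simp] theorem not_endsDistributing_nil : ¬ G.EndsDistributing [] := by
  simp [EndsDistributing]

@[simp] theorem endsDistributing_cons_cons {e f : G.Edge} {p : List G.Edge} :
    G.EndsDistributing (e :: f :: p) ↔ G.EndsDistributing (f :: p) := by
  simp [EndsDistributing]

theorem startsCollecting_append {a b : List G.Edge} (ha : a ≠ []) :
    G.StartsCollecting (a ++ b) ↔ G.StartsCollecting a := by
  obtain ⟨e, a, rfl⟩ := List.exists_cons_of_ne_nil ha
  simp

theorem endsDistributing_append {a b : List G.Edge} (hb : b ≠ []) :
    G.EndsDistributing (a ++ b) ↔ G.EndsDistributing b := by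
  simp [EndsDistributing, List.getLast?_append_of_ne_nil _ hb]

theorem StartsCollecting.ne_nil {p : List G.Edge} (h : G.StartsCollecting p) : p ≠ [] := by
  rintro rfl
  exact not_startsCollecting_nil h

theorem EndsDistributing.ne_nil {p : List G.Edge} (h : G.EndsDistributing p) : p ≠ [] := by
  rintro rfl
  exact not_endsDistributing_nil h

theorem isSymmetricPath_iff {p : List G.Edge} :
    G.IsSymmetricPath p ↔ G.Linked p ∧ G.StartsCollecting p ∧ G.EndsDistributing p :=
  ⟨fun h => ⟨h.1.2, h.2⟩, fun h => ⟨⟨h.2.1.ne_nil, h.1⟩, h.2⟩⟩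

theorem IsSymmetricPath.ne_nil {p : List G.Edge} (h : G.IsSymmetricPath p) : p ≠ [] := h.1.1

theorem IsSymmetricPath.linked {p : List G.Edge} (h : G.IsSymmetricPath p) : G.Linked p := h.1.2

theorem isSymmetricPath_singleton {v : G.Edge} (hv : G.IsSupportEdge v) :
    G.IsSymmetricPath [v] :=
  isSymmetricPath_iff.2 ⟨List.isChain_singleton v, startsCollecting_cons.2 hv.1,
    endsDistributing_singleton.2 hv.2⟩

theorem isSymmetricPath_of_append {p q r : List G.Edge} (h : G.Linked (p ++ q ++ r))
    (hp : G.StartsCollecting p) (hr : G.EndsDistributing r) : G.IsSymmetricPath (p ++ q ++ r) := by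
  refine isSymmetricPath_iff.2 ⟨h, ?_, (endsDistributing_append hr.ne_nil).2 hr⟩
  rw [List.append_assoc]
  exact (startsCollecting_append hp.ne_nil).2 hp

theorem IsDistributing.not_isCollecting {x : G.Vert} (h : G.IsDistributing x) :
    ¬ G.IsCollecting x :=
  fun h' => h'.1.ne' h.1

theorem IsCollecting.not_isDistributing {x : G.Vert} (h : G.IsCollecting x) :
    ¬ G.IsDistributing x := fun h' => h'.not_isCollecting h

theorem IsCollecting.eq_of_src {e f : G.Edge} (h : G.IsCollecting (G.src e))
    (hf : G.src f = G.src e) : f = e :=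
  Set.encard_le_one_iff.1 h.2.le f e hf rfl

theorem Linked.prefix_of_length_le {good : G.Edge → Prop} {p q : List G.Edge} {e : G.Edge}
    (hp : G.Linked (e :: p)) (hq : G.Linked (e :: q))
    (hdet : ∀ f ∈ p, ∀ g, good g → G.src g = G.src f → g = f) (hgood : ∀ g ∈ q, good g)
    (hlen : p.length ≤ q.length) : p <+: q := by
  induction p generalizing q e with
  | nil => exact List.nil_prefix
  | cons f p ih =>
    cases q with
    | nil => simp at hlen
    | cons g q =>
      obtain ⟨hf, hp⟩ := List.isChain_cons_cons.1 hp
      obtain ⟨hg, hq⟩ := List.isChain_cons_cons.1 hq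
      obtain rfl := hdet f List.mem_cons_self g (hgood g List.mem_cons_self) (hg.symm.trans hf)
      rw [List.prefix_cons_inj]
      exact ih hp hq (fun f' hf' => hdet f' (List.mem_cons_of_mem _ hf'))
        (fun g' hg' => hgood g' (List.mem_cons_of_mem _ hg')) (by simpa using hlen)

/-- The graph with all edges reversed; it exchanges distributing and collecting vertices, and
with them the two halves of every argument. -/
abbrev reverse (G : MultiDigraph.{u}) : MultiDigraph.{u} where
  Vert := G.Vert
  Edge := G.Edge
  src := G.tgt
  tgt := G.src

theorem isDistributing_reverse {x : G.Vert} : G.reverse.IsDistributing x ↔ G.IsCollecting x :=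
  and_comm

theorem isCollecting_reverse {x : G.Vert} : G.reverse.IsCollecting x ↔ G.IsDistributing x :=
  and_comm

theorem linked_reverse {p : List G.Edge} : G.reverse.Linked p.reverse ↔ G.Linked p := by
  rw [Linked, List.isChain_reverse]
  exact ⟨fun h => h.imp fun _ _ h => h.symm, fun h => h.imp fun _ _ h => h.symm⟩

theorem isPath_reverse {p : List G.Edge} : G.reverse.IsPath p.reverse ↔ G.IsPath p :=
  and_congr List.reverse_eq_nil_iff.not linked_reverse

theorem startsCollecting_reverse {p : List G.Edge} :
    G.reverse.StartsCollecting p.reverse ↔ G.EndsDistributing p := by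
  simp only [StartsCollecting, EndsDistributing, List.head?_reverse, isCollecting_reverse]

theorem endsDistributing_reverse {p : List G.Edge} :
    G.reverse.EndsDistributing p.reverse ↔ G.StartsCollecting p := by
  simp only [StartsCollecting, EndsDistributing, List.getLast?_reverse, isDistributing_reverse]

theorem isSymmetricPath_reverse {p : List G.Edge} :
    G.reverse.IsSymmetricPath p.reverse ↔ G.IsSymmetricPath p :=
  and_congr isPath_reverse
    ((and_congr startsCollecting_reverse endsDistributing_reverse).trans and_comm)

theorem isRightExtension_reverse {s p : List G.Edge} :
    G.reverse.IsRightExtension s.reverse p.reverse ↔ G.IsLeftExtension s p := by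
  simp only [IsRightExtension, IsLeftExtension, isPath_reverse, endsDistributing_reverse,
    List.reverse_prefix]
  refine and_congr_right fun _ => List.reverse_involutive.surjective.forall.trans ?_
  simp only [isPath_reverse, endsDistributing_reverse, List.reverse_prefix, List.length_reverse]

end MultiDigraph

namespace WordGraph

open MultiDigraph

variable {α : Type w} {S : WordGraph.{u, w} α}

open Classical in
/-- The part of `F(a ++ p)` contributed by `p`, when `a` is a nonempty path. -/
noncomputable def innerFront (S : WordGraph.{u, w} α) (p : List S.Edge) : List α :=
  (p.filter (fun f => S.IsDistributing (S.src f))).flatMap S.front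

open Classical in
/-- The part of `B(p ++ b)` contributed by `p`, when `b` is a nonempty path. -/
noncomputable def innerBack (S : WordGraph.{u, w} α) (p : List S.Edge) : List α :=
  (p.filter (fun f => S.IsCollecting (S.tgt f))).flatMap S.back

theorem frontWord_cons (e : S.Edge) (p : List S.Edge) :
    S.frontWord (e :: p) = S.front e ++ S.innerFront p := rfl

theorem backWord_concat (p : List S.Edge) (e : S.Edge) :
    S.backWord (p ++ [e]) = S.innerBack p ++ S.back e := by
  simp [backWord, innerBack]

@[simp] theorem innerFront_nil : S.innerFront [] = [] := rfl

@[simp] theorem innerBack_nil : S.innerBack [] = [] := rfl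

@[simp] theorem innerFront_append (p q : List S.Edge) :
    S.innerFront (p ++ q) = S.innerFront p ++ S.innerFront q := by
  simp [innerFront]

@[simp] theorem innerBack_append (p q : List S.Edge) :
    S.innerBack (p ++ q) = S.innerBack p ++ S.innerBack q := by
  simp [innerBack]

theorem innerFront_cons (e : S.Edge) (p : List S.Edge) :
    S.innerFront (e :: p) = S.innerFront [e] ++ S.innerFront p := innerFront_append [e] p

theorem innerBack_cons (e : S.Edge) (p : List S.Edge) :
    S.innerBack (e :: p) = S.innerBack [e] ++ S.innerBack p := innerBack_append [e] p

theorem innerFront_singleton_of_isDistributing {e : S.Edge} (h : S.IsDistributing (S.src e)) :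
    S.innerFront [e] = S.front e := by
  simp [innerFront, h]

theorem innerBack_singleton_of_isCollecting {e : S.Edge} (h : S.IsCollecting (S.tgt e)) :
    S.innerBack [e] = S.back e := by
  simp [innerBack, h]

theorem innerFront_cons_of_isDistributing {e : S.Edge} (h : S.IsDistributing (S.src e))
    (p : List S.Edge) : S.innerFront (e :: p) = S.front e ++ S.innerFront p := by
  simp [innerFront, h]

theorem innerFront_cons_of_not {e : S.Edge} (h : ¬ S.IsDistributing (S.src e))
    (p : List S.Edge) : S.innerFront (e :: p) = S.innerFront p := by
  simp [innerFront, h]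

theorem innerBack_concat_of_isCollecting {e : S.Edge} (h : S.IsCollecting (S.tgt e))
    (p : List S.Edge) : S.innerBack (p ++ [e]) = S.innerBack p ++ S.back e := by
  simp [innerBack, h]

theorem innerBack_concat_of_not {e : S.Edge} (h : ¬ S.IsCollecting (S.tgt e))
    (p : List S.Edge) : S.innerBack (p ++ [e]) = S.innerBack p := by
  simp [innerBack, h]

theorem innerFront_singleton_of_not {e : S.Edge} (h : ¬ S.IsDistributing (S.src e)) :
    S.innerFront [e] = [] := innerFront_cons_of_not h []

theorem innerBack_singleton_of_not {e : S.Edge} (h : ¬ S.IsCollecting (S.tgt e)) :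
    S.innerBack [e] = [] := innerBack_concat_of_not h []

theorem frontWord_append {p : List S.Edge} (hp : p ≠ []) (q : List S.Edge) :
    S.frontWord (p ++ q) = S.frontWord p ++ S.innerFront q := by
  obtain ⟨e, p, rfl⟩ := List.exists_cons_of_ne_nil hp
  simp [frontWord_cons]

theorem backWord_append (p : List S.Edge) {q : List S.Edge} (hq : q ≠ []) :
    S.backWord (p ++ q) = S.innerBack p ++ S.backWord q := by
  rcases List.eq_nil_or_concat' q with rfl | ⟨q, e, rfl⟩
  · exact absurd rfl hq
  · rw [← List.append_assoc, backWord_concat, backWord_concat, innerBack_append, List.append_assoc]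

theorem frontWord_eq_innerFront {e : S.Edge} (h : S.IsDistributing (S.src e)) (p : List S.Edge) :
    S.frontWord (e :: p) = S.innerFront (e :: p) := by
  rw [frontWord_cons, innerFront_cons_of_isDistributing h]

theorem backWord_eq_innerBack {e : S.Edge} (h : S.IsCollecting (S.tgt e)) (p : List S.Edge) :
    S.backWord (p ++ [e]) = S.innerBack (p ++ [e]) := by
  rw [backWord_concat, innerBack_concat_of_isCollecting h]

theorem frontWord_append_append
    (hword : ∀ p, S.IsSymmetricPath p → S.frontWord p = S.backWord p) {a p b : List S.Edge}
    (hP : S.IsSymmetricPath (a ++ p ++ b)) (hp : S.IsSymmetricPath p) :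
    S.frontWord (a ++ p ++ b) = S.innerBack a ++ S.frontWord p ++ S.innerFront b := by
  have hap_ne : a ++ p ≠ [] := List.append_ne_nil_of_right_ne_nil _ hp.ne_nil
  have hap : S.IsSymmetricPath (a ++ p) := isSymmetricPath_iff.2
    ⟨hP.linked.left, (startsCollecting_append hap_ne).1 hP.2.1,
      (endsDistributing_append hp.ne_nil).2 hp.2.2⟩
  rw [frontWord_append hap_ne, hword _ hap, backWord_append _ hp.ne_nil, hword _ hp]

/-- The graph with all edges and all words reversed; it exchanges front and back words. -/
abbrev reverse (S : WordGraph.{u, w} α) : WordGraph.{u, w} α where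
  toMultiDigraph := S.toMultiDigraph.reverse
  front e := (S.back e).reverse
  back e := (S.front e).reverse

theorem innerFront_reverse (p : List S.Edge) :
    S.reverse.innerFront p.reverse = (S.innerBack p).reverse := by
  induction p using List.reverseRecOn with
  | nil => rfl
  | append_singleton p e ih =>
    rw [List.reverse_append, List.reverse_singleton, List.singleton_append]
    by_cases h : S.IsCollecting (S.tgt e)
    · rw [innerBack_concat_of_isCollecting h, List.reverse_append, ← ih]
      exact innerFront_cons_of_isDistributing (S := S.reverse) (isDistributing_reverse.2 h) _
    · rw [innerBack_concat_of_not h, ← ih]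
      exact innerFront_cons_of_not (S := S.reverse) (mt isDistributing_reverse.1 h) _

theorem frontWord_reverse (p : List S.Edge) :
    S.reverse.frontWord p.reverse = (S.backWord p).reverse := by
  rcases List.eq_nil_or_concat' p with rfl | ⟨q, e, rfl⟩
  · rfl
  · rw [backWord_concat, List.reverse_append, List.reverse_append, List.reverse_singleton,
      List.singleton_append, ← innerFront_reverse, frontWord_cons]

theorem backWord_reverse (p : List S.Edge) :
    S.reverse.backWord p.reverse = (S.frontWord p).reverse := by
  have h_involutive : S.reverse.reverse = S := by simp [reverse, MultiDigraph.reverse]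
  have h := frontWord_reverse (S := S.reverse) p.reverse
  rw [List.reverse_reverse] at h
  rw [← List.reverse_reverse (S.reverse.backWord p.reverse), ← h]
  congr 2

end WordGraph

section Words

variable {α : Type w} {W : ℕ → α}

/-- The block `W[i] … W[i + n - 1]`. -/
def block (W : ℕ → α) (i n : ℕ) : List α := (List.range n).map fun j => W (i + j)

@[simp] theorem length_block (i n : ℕ) : (block W i n).length = n := by simp [block]

theorem getElem_block {i n j : ℕ} (h : j < (block W i n).length) :
    (block W i n)[j] = W (i + j) := by simp [block]

theorem block_add (i m n : ℕ) : block W i (m + n) = block W i m ++ block W (i + m) n := by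
  simp [block, List.range_add, Function.comp_def, add_assoc]

theorem occursAt_iff {u : List α} {i : ℕ} : OccursAt u W i ↔ u = block W i u.length := by
  refine ⟨fun h => List.ext_getElem (length_block i _).symm fun j hj _ => ?_, fun h j hj => ?_⟩
  · rw [h j hj, getElem_block]
  · rw [List.getElem_of_eq h hj, getElem_block]

theorem occursAt_block (i n : ℕ) : OccursAt (block W i n) W i := by
  rw [occursAt_iff, length_block]

theorem isSubword_block (i n : ℕ) : IsSubword (block W i n) W := ⟨i, occursAt_block i n⟩

theorem isSubword_nil : IsSubword [] W := isSubword_block 0 0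

theorem OccursAt.append_block {u t : List α} {i d : ℕ} (hu : OccursAt u W i)
    (ht : OccursAt t W (i + u.length + d)) :
    u ++ block W (i + u.length) d ++ t = block W i (u.length + d + t.length) := by
  rw [block_add, block_add, ← occursAt_iff.1 hu, ← add_assoc i, ← occursAt_iff.1 ht]

theorem OccursAt.of_append {a u b : List α} {i : ℕ} (h : OccursAt (a ++ u ++ b) W i) :
    OccursAt u W (i + a.length) := by
  rw [occursAt_iff] at h ⊢
  rw [List.length_append, List.length_append, block_add, block_add] at h
  have hau : a ++ u = _ := (List.append_inj h (by simp)).1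
  exact (List.append_inj hau (by simp)).2

theorem IsSubword.of_infix {u t : List α} (h : IsSubword t W) (hu : u <:+: t) :
    IsSubword u W := by
  obtain ⟨a, b, rfl⟩ := hu
  obtain ⟨i, hi⟩ := h
  exact ⟨_, hi.of_append⟩

theorem IsRecurrent.exists_occursAt_add (hW : IsRecurrent W) {u : List α} (hu : IsSubword u W)
    (n : ℕ) : ∃ d, 0 < d ∧ OccursAt u W (n + d) := by
  obtain ⟨i, hi, hn⟩ := (hW u hu).exists_gt n
  exact ⟨i - n, Nat.sub_pos_of_lt hn, by rwa [Nat.add_sub_cancel' hn.le]⟩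

theorem IsRecurrent.exists_isSubword_append (hW : IsRecurrent W) {u t : List α}
    (hu : IsSubword u W) (ht : IsSubword t W) : ∃ z, z ≠ [] ∧ IsSubword (u ++ z ++ t) W := by
  obtain ⟨i, hi⟩ := hu
  obtain ⟨d, hd, hocc⟩ := hW.exists_occursAt_add ht (i + u.length)
  refine ⟨block W (i + u.length) d, List.ne_nil_of_length_pos (by simpa using hd), ?_⟩
  rw [hi.append_block hocc]
  exact isSubword_block _ _

theorem IsRecurrent.isPeriodic_of_eventually (hW : IsRecurrent W) {N d : ℕ} (hd : 0 < d)
    (h : ∀ n, W (N + n) = W (N + d + n)) : IsPeriodic W := by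
  refine ⟨d, hd, fun n => ?_⟩
  obtain ⟨k, -, hocc⟩ := hW.exists_occursAt_add (isSubword_block (W := W) 0 (n + d + 1)) N
  have h_shift : ∀ j < n + d + 1, W j = W (N + k + j) := fun j hj => by
    have hj' := hocc j (by simpa using hj)
    rwa [getElem_block, zero_add] at hj'
  rw [h_shift n (by omega), h_shift (n + d) (by omega), add_assoc N k n, h]
  congr 1
  omega

end Words

section Occurrences

variable {β : Type*}

/-- The occurrences of `u` in `t`, as factorizations of `t`; `OccursAtLeast` counts them. -/
def occurrences (u t : List β) : Set (List β × List β) := {d | d.1 ++ u ++ d.2 = t}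

theorem finite_occurrences (u t : List β) : (occurrences u t).Finite := by
  refine ((List.finite_toSet t.inits).prod (List.finite_toSet t.tails)).subset ?_
  rintro ⟨a, b⟩ rfl
  exact ⟨(List.mem_inits _ _).2 ⟨u ++ b, (List.append_assoc _ _ _).symm⟩,
    (List.mem_tails _ _).2 (List.suffix_append _ _)⟩

end Occurrences

namespace WordGraph

open MultiDigraph

variable {α : Type w} {S : WordGraph.{u, w} α}

theorem innerBack_ne_nil (hback : ∀ e, S.IsCollecting (S.tgt e) → S.back e ≠ [])
    {a p : List S.Edge} (h : S.Linked (a ++ p)) (hp : S.StartsCollecting p) (ha : a ≠ []) :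
    S.innerBack a ≠ [] := by
  obtain ⟨a, e, rfl⟩ := (List.eq_nil_or_concat' a).resolve_left ha
  obtain ⟨f, p, rfl⟩ := List.exists_cons_of_ne_nil hp.ne_nil
  rw [List.append_assoc, List.singleton_append] at h
  have he : S.IsCollecting (S.tgt e) := h.tgt_eq_src ▸ startsCollecting_cons.1 hp
  rw [innerBack_concat_of_isCollecting he]
  exact List.append_ne_nil_of_right_ne_nil _ (hback e he)

theorem eq_of_innerBack_eq (hback : ∀ e, S.IsCollecting (S.tgt e) → S.back e ≠ [])
    {a b a' b' p : List S.Edge} (hl : S.Linked (a ++ p ++ b)) (hp : S.StartsCollecting p)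
    (h : a ++ p ++ b = a' ++ p ++ b') (haa : S.innerBack a = S.innerBack a') : a = a' := by
  wlog hlen : a.length ≤ a'.length generalizing a b a' b'
  · exact (this (h ▸ hl) h.symm haa.symm (le_of_not_ge hlen)).symm
  obtain ⟨c, rfl⟩ : a <+: a' := List.prefix_of_prefix_length_le
    ⟨p ++ b, (List.append_assoc _ _ _).symm.trans h⟩ ⟨p ++ b', (List.append_assoc _ _ _).symm⟩ hlen
  rw [innerBack_append, List.self_eq_append_right] at haa
  rw [h] at hl
  have hcp : S.Linked (c ++ p) := (List.append_assoc a c p ▸ hl.left).right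
  by_contra hc
  exact innerBack_ne_nil hback hcp hp (fun hnil => hc (by rw [hnil, List.append_nil])) haa

/-- Property 4 with positions: every occurrence of the front word of a symmetric path `p` in that
of a symmetric path `q` is read off an occurrence of `p` in `q`. -/
def IsSynchronized (S : WordGraph.{u, w} α) : Prop :=
  ∀ p q, S.IsSymmetricPath p → S.IsSymmetricPath q → ∀ s t,
    S.frontWord q = s ++ S.frontWord p ++ t → ∃ a b, q = a ++ p ++ b ∧ S.innerBack a = s

/-- An occurrence of `p` in `q` induces one of `F(p)` in `F(q)`, injectively since the words
`B(e)` are nonempty; as property 4 gives at least as many of the former, all of the latter are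
induced. -/
theorem isSynchronized_of_path_occurs
    (hback : ∀ e, S.IsCollecting (S.tgt e) → S.back e ≠ [])
    (hword : ∀ p, S.IsSymmetricPath p → S.frontWord p = S.backWord p)
    (hocc : ∀ p q, S.IsSymmetricPath p → S.IsSymmetricPath q → ∀ k : ℕ,
      OccursAtLeast k (S.frontWord p) (S.frontWord q) → OccursAtLeast k p q) :
    S.IsSynchronized := by
  intro p q hp hq s t hst
  let word : List S.Edge × List S.Edge → List α × List α :=
    fun d => (S.innerBack d.1, S.innerFront d.2)
  have hfin := finite_occurrences (S.frontWord p) (S.frontWord q)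
  have hmaps : word '' occurrences p q ⊆ occurrences (S.frontWord p) (S.frontWord q) := by
    rintro _ ⟨⟨a, b⟩, rfl, rfl⟩
    exact (frontWord_append_append hword hq hp).symm
  have hinj : Set.InjOn word (occurrences p q) := by
    rintro ⟨a, b⟩ rfl ⟨a', b'⟩ hab' heq
    obtain rfl := eq_of_innerBack_eq hback hq.linked hp.2.1 (Eq.symm hab') (congrArg Prod.fst heq)
    exact Prod.ext rfl (List.append_cancel_left hab').symm
  have hcard : (occurrences (S.frontWord p) (S.frontWord q)).encard ≤
      (word '' occurrences p q).encard := by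
    rw [hinj.encard_image, ← hfin.cast_ncard_eq]
    exact hocc p q hp hq _ hfin.cast_ncard_eq.le
  have hsurj := (hfin.subset hmaps).eq_of_subset_of_encard_le hmaps hcard
  obtain ⟨⟨a, b⟩, hab, heq⟩ : (s, t) ∈ word '' occurrences p q := hsurj ▸ hst.symm
  exact ⟨a, b, Eq.symm hab, congrArg Prod.fst heq⟩

theorem IsSynchronized.path_occurs (hS : S.IsSynchronized)
    {p q : List S.Edge} (hp : S.IsSymmetricPath p) (hq : S.IsSymmetricPath q) (k : ℕ)
    (h : OccursAtLeast k (S.frontWord p) (S.frontWord q)) : OccursAtLeast k p q := by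
  let word : List S.Edge × List S.Edge → List α × List α := fun d =>
    (S.innerBack d.1, (S.frontWord q).drop (S.innerBack d.1 ++ S.frontWord p).length)
  have hsurj : occurrences (S.frontWord p) (S.frontWord q) ⊆ word '' occurrences p q := by
    rintro ⟨s, t⟩ hst
    obtain ⟨a, b, hab, rfl⟩ := hS p q hp hq s t (Eq.symm hst)
    refine ⟨(a, b), hab.symm, Prod.ext rfl ?_⟩
    change (S.frontWord q).drop _ = t
    rw [← (show _ = S.frontWord q from hst), List.drop_left]
  exact h.trans ((Set.encard_le_encard hsurj).trans (Set.encard_image_le _ _))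

theorem length_innerBack_le (p : List S.Edge) :
    (S.innerBack p).length ≤ (S.backWord p).length := by
  rcases List.eq_nil_or_concat' p with rfl | ⟨p, e, rfl⟩
  · simp
  · by_cases h : S.IsCollecting (S.tgt e)
    · rw [backWord_eq_innerBack h]
    · rw [innerBack_concat_of_not h, backWord_concat]
      simp

theorem IsSynchronized.exists_subpath (hsync : S.IsSynchronized)
    (hword : ∀ p, S.IsSymmetricPath p → S.frontWord p = S.backWord p)
    {p q₁ q₂ : List S.Edge} (hp : S.IsSymmetricPath p) (h₁ : S.IsSymmetricPath q₁)
    (h₂ : S.IsSymmetricPath q₂) {s z t : List α} (hz : z ≠ [])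
    (h : S.frontWord p = s ++ (S.frontWord q₁ ++ z ++ S.frontWord q₂) ++ t) :
    ∃ a r b, p = a ++ (q₁ ++ r ++ q₂) ++ b ∧ S.innerBack a = s ∧ S.innerFront b = t := by
  obtain ⟨a, b₁, hab₁, ha⟩ := hsync q₁ p h₁ hp s (z ++ S.frontWord q₂ ++ t) (by simp [h])
  obtain ⟨c, b, hcb, hc⟩ := hsync q₂ p h₂ hp (s ++ S.frontWord q₁ ++ z) t (by simp [h])
  have hlen : (S.innerBack (a ++ q₁)).length < (S.innerBack c).length := by
    have hq₁ := length_innerBack_le q₁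
    rw [← hword _ h₁] at hq₁
    have hz := List.length_pos_iff.2 hz
    simp only [innerBack_append, ha, hc, List.length_append]
    omega
  obtain ⟨r, rfl⟩ : a ++ q₁ <+: c := by
    rcases List.prefix_or_prefix_of_prefix (l₁ := a ++ q₁) (l₂ := c) (l₃ := p)
      ⟨b₁, hab₁.symm⟩ ⟨q₂ ++ b, by rw [hcb, List.append_assoc]⟩ with hpre | ⟨d, hd⟩
    · exact hpre
    · rw [← hd, innerBack_append, List.length_append] at hlen
      omega
  refine ⟨a, r, b, by simp [hcb], ha, ?_⟩
  have hF := frontWord_append_append hword (hcb ▸ hp) h₂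
  rw [← hcb, hc, h] at hF
  simpa using hF.symm

/-- Properties 3 and 6 of a Rauzy scheme and property 4 in its synchronized form, together with the
presence of a symmetric path: what is needed to read `W` along symmetric paths. -/
structure Encodes (S : WordGraph.{u, w} α) (W : ℕ → α) : Prop where
  isSynchronized : S.IsSynchronized
  front_eq_back : ∀ p, S.IsSymmetricPath p → S.frontWord p = S.backWord p
  subword_covered : ∀ u, IsSubword u W → ∃ p, S.IsSymmetricPath p ∧ u <:+: S.frontWord p
  exists_isSubword : ∃ p, S.IsSymmetricPath p ∧ IsSubword (S.frontWord p) W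

/-- Property 7 for the edge `e`. -/
def IsForced (S : WordGraph.{u, w} α) (W : ℕ → α) (e : S.Edge) : Prop :=
  ∃ u, IsSubword u W ∧ ∀ p, S.IsSymmetricPath p → u <:+: S.frontWord p → e ∈ p

namespace Encodes

variable {W : ℕ → α}

theorem exists_path_eq_append (hS : S.Encodes W) {q₁ q₂ : List S.Edge}
    (h₁ : S.IsSymmetricPath q₁) (h₂ : S.IsSymmetricPath q₂) {z : List α} (hz : z ≠ [])
    (h : IsSubword (S.frontWord q₁ ++ z ++ S.frontWord q₂) W) :
    ∃ r, S.IsSymmetricPath (q₁ ++ r ++ q₂) ∧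
      S.frontWord (q₁ ++ r ++ q₂) = S.frontWord q₁ ++ z ++ S.frontWord q₂ := by
  obtain ⟨p, hp, s, t, hst⟩ := hS.subword_covered _ h
  obtain ⟨a, r, b, rfl, rfl, rfl⟩ :=
    hS.isSynchronized.exists_subpath hS.front_eq_back hp h₁ h₂ hz hst.symm
  have hr : S.IsSymmetricPath (q₁ ++ r ++ q₂) :=
    isSymmetricPath_of_append hp.linked.left.right h₁.2.1 h₂.2.2
  rw [frontWord_append_append hS.front_eq_back hp hr] at hst
  exact ⟨r, hr, (List.append_cancel_left (List.append_cancel_right hst)).symm⟩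

theorem exists_join (hS : S.Encodes W) (hrec : IsRecurrent W) {q₁ q₂ : List S.Edge}
    (h₁ : S.IsSymmetricPath q₁) (h₂ : S.IsSymmetricPath q₂)
    (hw₁ : IsSubword (S.frontWord q₁) W) (hw₂ : IsSubword (S.frontWord q₂) W) :
    ∃ r, S.IsSymmetricPath (q₁ ++ r ++ q₂) ∧ IsSubword (S.frontWord (q₁ ++ r ++ q₂)) W := by
  obtain ⟨z, hz, hsub⟩ := hrec.exists_isSubword_append hw₁ hw₂
  obtain ⟨r, hr, hword⟩ := hS.exists_path_eq_append h₁ h₂ hz hsub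
  exact ⟨r, hr, hword ▸ hsub⟩

theorem exists_cover_between (hS : S.Encodes W) (hrec : IsRecurrent W) {q : List S.Edge}
    (hq : S.IsSymmetricPath q) (hqw : IsSubword (S.frontWord q) W) {u : List α}
    (hu : IsSubword u W) : ∃ r, S.IsSymmetricPath (q ++ r ++ q) ∧
      u <:+: S.frontWord (q ++ r ++ q) ∧ IsSubword (S.frontWord (q ++ r ++ q)) W := by
  obtain ⟨z, hz, hzw⟩ := hrec.exists_isSubword_append hqw hu
  obtain ⟨z', -, hsub⟩ := hrec.exists_isSubword_append hzw hqw
  rw [show S.frontWord q ++ z ++ u ++ z' = S.frontWord q ++ (z ++ u ++ z') by simp] at hsub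
  obtain ⟨r, hr, hword⟩ := hS.exists_path_eq_append hq hq (by simp [hz]) hsub
  exact ⟨r, hr, ⟨S.frontWord q ++ z, z' ++ S.frontWord q, by rw [hword]; simp⟩, hword ▸ hsub⟩

theorem exists_cover_isSubword (hS : S.Encodes W) (hrec : IsRecurrent W) {u : List α}
    (hu : IsSubword u W) :
    ∃ p, S.IsSymmetricPath p ∧ u <:+: S.frontWord p ∧ IsSubword (S.frontWord p) W := by
  obtain ⟨q, hq, hqw⟩ := hS.exists_isSubword
  obtain ⟨r, hr⟩ := hS.exists_cover_between hrec hq hqw hu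
  exact ⟨_, hr⟩

theorem exists_path_through (hS : S.Encodes W) (hrec : IsRecurrent W) {e f : S.Edge}
    (he : S.IsForced W e) (hf : S.IsForced W f) {u : List α} (hu : IsSubword u W) :
    ∃ a m p n b, S.IsSymmetricPath (a ++ e :: m ++ p ++ n ++ f :: b) ∧
      IsSubword (S.frontWord (a ++ e :: m ++ p ++ n ++ f :: b)) W ∧
      S.IsSymmetricPath p ∧ u <:+: S.frontWord p := by
  obtain ⟨uₑ, huₑ, hforce_e⟩ := he
  obtain ⟨u_f, hu_f, hforce_f⟩ := hf
  obtain ⟨p₁, hp₁, hu₁, hw₁⟩ := hS.exists_cover_isSubword hrec huₑ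
  obtain ⟨p, hp, hup, hw⟩ := hS.exists_cover_isSubword hrec hu
  obtain ⟨p₂, hp₂, hu₂, hw₂⟩ := hS.exists_cover_isSubword hrec hu_f
  obtain ⟨r, hr, hrw⟩ := hS.exists_join hrec hp₁ hp hw₁ hw
  obtain ⟨r', hr', hrw'⟩ := hS.exists_join hrec hr hp₂ hrw hw₂
  obtain ⟨a, m, rfl⟩ := List.append_of_mem (hforce_e _ hp₁ hu₁)
  obtain ⟨n, b, rfl⟩ := List.append_of_mem (hforce_f _ hp₂ hu₂)
  refine ⟨a, m ++ r, p, r' ++ n, b, ?_⟩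
  simp only [List.append_assoc, List.cons_append] at hr' hrw' ⊢
  exact ⟨hr', hrw', hp, hup⟩

theorem exists_path_eq_block (hS : S.Encodes W) (hrec : IsRecurrent W) {q : List S.Edge}
    (hq : S.IsSymmetricPath q) {i : ℕ} (hi : OccursAt (S.frontWord q) W i) (n : ℕ) :
    ∃ r m, n < m ∧ S.IsSymmetricPath (q ++ r) ∧ S.frontWord (q ++ r) = block W i m := by
  obtain ⟨d, hd, hocc⟩ := hrec.exists_occursAt_add ⟨i, hi⟩ (i + (S.frontWord q).length + n)
  rw [add_assoc _ n d] at hocc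
  have hblock := hi.append_block hocc
  obtain ⟨r, hr, hword⟩ := hS.exists_path_eq_append hq hq
    (List.ne_nil_of_length_pos (by rw [length_block]; omega)) (hblock ▸ isSubword_block _ _)
  rw [List.append_assoc] at hr hword
  exact ⟨r ++ q, _, by omega, hr, hword.trans hblock⟩

end Encodes

theorem frontWord_prefix_or_prefix {good : S.Edge → Prop}
    (huniq : ∀ e f, good e → good f → S.src e = S.src f → e = f) {e : S.Edge}
    {p q : List S.Edge} (hp : S.Linked (e :: p)) (hq : S.Linked (e :: q))
    (hp_good : ∀ f ∈ p, good f) (hq_good : ∀ f ∈ q, good f) :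
    S.frontWord (e :: p) <+: S.frontWord (e :: q) ∨
      S.frontWord (e :: q) <+: S.frontWord (e :: p) := by
  wlog hlen : p.length ≤ q.length generalizing p q
  · exact (this hq hp hq_good hp_good (le_of_not_ge hlen)).symm
  obtain ⟨c, rfl⟩ := hp.prefix_of_length_le hq
    (fun f hf g hg hgf => huniq g f hg (hp_good f hf) hgf) hq_good hlen
  left
  rw [← List.cons_append, frontWord_append (List.cons_ne_nil _ _)]
  exact List.prefix_append _ _

/-- Reading on from any two occurrences of the same word, one is forced along the same path. -/
theorem Encodes.isPeriodic_of_unique_good {W : ℕ → α} (hS : S.Encodes W) (hrec : IsRecurrent W)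
    {good : S.Edge → Prop}
    (hgood : ∀ p, S.IsSymmetricPath p → IsSubword (S.frontWord p) W → ∀ e ∈ p, good e)
    (huniq : ∀ e f, good e → good f → S.src e = S.src f → e = f) : IsPeriodic W := by
  obtain ⟨q, hq, i, hi⟩ := hS.exists_isSubword
  obtain ⟨d, hd, hi'⟩ := hrec.exists_occursAt_add ⟨i, hi⟩ i
  obtain ⟨e, q, rfl⟩ := List.exists_cons_of_ne_nil hq.ne_nil
  refine hrec.isPeriodic_of_eventually (N := i) hd fun n => ?_
  obtain ⟨r, m, hm, hr, hword⟩ := hS.exists_path_eq_block hrec hq hi n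
  obtain ⟨r', m', hm', hr', hword'⟩ := hS.exists_path_eq_block hrec hq hi' n
  have hr_good := hgood _ hr (hword ▸ isSubword_block _ _)
  have hr_good' := hgood _ hr' (hword' ▸ isSubword_block _ _)
  have hprefix : S.frontWord (e :: q ++ r) <+: S.frontWord (e :: q ++ r') ∨
      S.frontWord (e :: q ++ r') <+: S.frontWord (e :: q ++ r) :=
    frontWord_prefix_or_prefix huniq hr.linked hr'.linked
      (fun f hf => hr_good f (List.mem_cons_of_mem _ hf))
      (fun f hf => hr_good' f (List.mem_cons_of_mem _ hf))
  rw [hword, hword'] at hprefix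
  have hn : n < (block W i m).length := by rwa [length_block]
  have hn' : n < (block W (i + d) m').length := by rwa [length_block]
  rw [← getElem_block hn, ← getElem_block hn']
  rcases hprefix with h | h
  · exact h.getElem hn
  · exact (h.getElem hn').symm

theorem frontWord_singleton (e : S.Edge) : S.frontWord [e] = S.front e := by
  rw [frontWord_cons, innerFront_nil, List.append_nil]

theorem IsRauzyScheme.encodes {W : ℕ → α} (hS : S.IsRauzyScheme W) {v : S.Edge}
    (hv : S.IsSupportEdge v) : S.Encodes W where
  isSynchronized := isSynchronized_of_path_occurs hS.back_ne_nil hS.front_eq_back hS.path_occurs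
  front_eq_back := hS.front_eq_back
  subword_covered := hS.subword_covered
  exists_isSubword := ⟨[v], isSymmetricPath_singleton hv, by
    rw [frontWord_singleton]
    exact hS.front_subword v⟩

end WordGraph

namespace WordGraph

open MultiDigraph

variable {α : Type w} {S : WordGraph.{u, w} α} {v : S.Edge} {hv : S.IsSupportEdge v}

namespace split

/-- The edge of `S'` given by an edge of `S` other than `v`. -/
def old (hv : S.IsSupportEdge v) (e : S.Edge) (he : e ≠ v) : (S.split v hv).Edge := .inl ⟨e, he⟩

/-- The edge `v_{ij}` of `S'`. -/
def new (hv : S.IsSupportEdge v) (x : S.InEdge v) (y : S.OutEdge v) : (S.split v hv).Edge :=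
  .inr (x, y)

/-- A vertex of `S'` that comes from `S`. -/
def oldVert (hv : S.IsSupportEdge v) (x : S.Vert) (hx : x ≠ S.src v ∧ x ≠ S.tgt v) :
    (S.split v hv).Vert := .inl ⟨x, hx⟩

/-- The vertex `A_i` of `S'`. -/
def inVert (hv : S.IsSupportEdge v) (x : S.InEdge v) : (S.split v hv).Vert := .inr (.inl x)

/-- The vertex `B_j` of `S'`. -/
def outVert (hv : S.IsSupportEdge v) (y : S.OutEdge v) : (S.split v hv).Vert := .inr (.inr y)

/-- The edge of `S` below an edge of `S'`; it is `v` for the edges `v_{ij}`. -/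
def base : (S.split v hv).Edge → S.Edge
  | .inl e => e.1
  | .inr _ => v

theorem edge_cases {motive : (S.split v hv).Edge → Prop}
    (h_old : ∀ e he, motive (old hv e he)) (h_new : ∀ x y, motive (new hv x y)) (e) : motive e := by
  rcases e with ⟨e, he⟩ | ⟨x, y⟩
  · exact h_old e he
  · exact h_new x y

theorem vert_cases {motive : (S.split v hv).Vert → Prop}
    (h_old : ∀ x hx, motive (oldVert hv x hx)) (h_in : ∀ x, motive (inVert hv x))
    (h_out : ∀ y, motive (outVert hv y)) (x) : motive x := by
  rcases x with ⟨x, hx⟩ | x | y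
  · exact h_old x hx
  · exact h_in x
  · exact h_out y

theorem src_ne_tgt (hv : S.IsSupportEdge v) : S.src v ≠ S.tgt v := fun h =>
  hv.1.not_isDistributing (h ▸ hv.2)

theorem inEdge_ne (hv : S.IsSupportEdge v) (x : S.InEdge v) : x.1 ≠ v := fun h =>
  src_ne_tgt hv (by rw [← x.2, h])

theorem outEdge_ne (hv : S.IsSupportEdge v) (y : S.OutEdge v) : y.1 ≠ v := fun h =>
  src_ne_tgt hv (by rw [← y.2, h])

theorem isCollecting_tgt_inEdge (hv : S.IsSupportEdge v) (x : S.InEdge v) :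
    S.IsCollecting (S.tgt x.1) := by
  rw [x.2]
  exact hv.1

theorem isDistributing_src_outEdge (hv : S.IsSupportEdge v) (y : S.OutEdge v) :
    S.IsDistributing (S.src y.1) := by
  rw [y.2]
  exact hv.2

@[simp] theorem base_old {e : S.Edge} {he : e ≠ v} : base (old hv e he) = e := rfl

@[simp] theorem base_new {x : S.InEdge v} {y : S.OutEdge v} : base (new hv x y) = v := rfl

@[simp] theorem src_new {x : S.InEdge v} {y : S.OutEdge v} :
    (S.split v hv).src (new hv x y) = inVert hv x := rfl

@[simp] theorem tgt_new {x : S.InEdge v} {y : S.OutEdge v} :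
    (S.split v hv).tgt (new hv x y) = outVert hv y := rfl

@[simp] theorem front_new {x : S.InEdge v} {y : S.OutEdge v} :
    (S.split v hv).front (new hv x y) = S.front y.1 := rfl

@[simp] theorem back_new {x : S.InEdge v} {y : S.OutEdge v} :
    (S.split v hv).back (new hv x y) = S.back x.1 := rfl

section OldEdges

variable {e : S.Edge} {he : e ≠ v}

theorem src_old_of_eq (h : S.src e = S.tgt v) :
    (S.split v hv).src (old hv e he) = outVert hv ⟨e, h⟩ := dif_pos h

theorem src_old_of_ne (h : S.src e ≠ S.tgt v) :
    (S.split v hv).src (old hv e he) = oldVert hv (S.src e) ⟨hv.src_ne he, h⟩ := dif_neg h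

theorem tgt_old_of_eq (h : S.tgt e = S.src v) :
    (S.split v hv).tgt (old hv e he) = inVert hv ⟨e, h⟩ := dif_pos h

theorem tgt_old_of_ne (h : S.tgt e ≠ S.src v) :
    (S.split v hv).tgt (old hv e he) = oldVert hv (S.tgt e) ⟨h, hv.tgt_ne he⟩ := dif_neg h

theorem front_old_of_eq (h : S.src e = S.tgt v) :
    (S.split v hv).front (old hv e he) = S.front v ++ S.front e := if_pos h

theorem front_old_of_ne (h : S.src e ≠ S.tgt v) :
    (S.split v hv).front (old hv e he) = S.front e := if_neg h

theorem back_old_of_eq (h : S.tgt e = S.src v) :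
    (S.split v hv).back (old hv e he) = S.back e ++ S.front v := if_pos h

theorem back_old_of_ne (h : S.tgt e ≠ S.src v) :
    (S.split v hv).back (old hv e he) = S.back e := if_neg h

end OldEdges

theorem oldVert_inj {x y : S.Vert} {hx hy} : oldVert hv x hx = oldVert hv y hy ↔ x = y :=
  ⟨fun h => congrArg Subtype.val (Sum.inl.inj h), by rintro rfl; rfl⟩

theorem inVert_inj {x y : S.InEdge v} : inVert hv x = inVert hv y ↔ x = y :=
  ⟨fun h => Sum.inl.inj (Sum.inr.inj h), by rintro rfl; rfl⟩

theorem outVert_inj {x y : S.OutEdge v} : outVert hv x = outVert hv y ↔ x = y :=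
  ⟨fun h => Sum.inr.inj (Sum.inr.inj h), by rintro rfl; rfl⟩

theorem new_inj {x x' : S.InEdge v} {y y' : S.OutEdge v} :
    new hv x y = new hv x' y' ↔ x = x' ∧ y = y' :=
  ⟨fun h => Prod.mk.inj (Sum.inr.inj h), by rintro ⟨rfl, rfl⟩; rfl⟩

@[simp] theorem oldVert_ne_inVert {x hx y} : oldVert hv x hx ≠ inVert hv y := by rintro ⟨⟩

@[simp] theorem oldVert_ne_outVert {x hx y} : oldVert hv x hx ≠ outVert hv y := by rintro ⟨⟩

@[simp] theorem inVert_ne_outVert {x y} : inVert hv x ≠ outVert hv y := by rintro ⟨⟩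

theorem eq_old_of_base_eq {f : (S.split v hv).Edge} {e : S.Edge} (h : base f = e) (he : e ≠ v) :
    f = old hv e he := by
  subst h
  induction f using edge_cases with
  | h_old e _ => rfl
  | h_new x y => exact absurd rfl he

theorem src_eq_oldVert {e : (S.split v hv).Edge} {x : S.Vert} {hx} :
    (S.split v hv).src e = oldVert hv x hx ↔ S.src (base e) = x := by
  induction e using edge_cases with
  | h_old e he =>
    by_cases h : S.src e = S.tgt v
    · simp [src_old_of_eq h, h, hx.2.symm, oldVert_ne_outVert.symm]
    · simp [src_old_of_ne h, oldVert_inj]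
  | h_new y z => simp [hx.1.symm, oldVert_ne_inVert.symm]

theorem tgt_eq_oldVert {e : (S.split v hv).Edge} {x : S.Vert} {hx} :
    (S.split v hv).tgt e = oldVert hv x hx ↔ S.tgt (base e) = x := by
  induction e using edge_cases with
  | h_old e he =>
    by_cases h : S.tgt e = S.src v
    · simp [tgt_old_of_eq h, h, hx.1.symm, oldVert_ne_inVert.symm]
    · simp [tgt_old_of_ne h, oldVert_inj]
  | h_new y z => simp [hx.2.symm, oldVert_ne_outVert.symm]

theorem tgt_eq_inVert {e : (S.split v hv).Edge} {x : S.InEdge v} :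
    (S.split v hv).tgt e = inVert hv x ↔ e = old hv x.1 (inEdge_ne hv x) := by
  refine ⟨fun h => ?_, by rintro rfl; exact tgt_old_of_eq x.2⟩
  induction e using edge_cases with
  | h_old e he =>
    by_cases htgt : S.tgt e = S.src v
    · rw [tgt_old_of_eq htgt, inVert_inj] at h
      subst h
      rfl
    · simp [tgt_old_of_ne htgt] at h
  | h_new y z => exact absurd h.symm inVert_ne_outVert

theorem src_eq_outVert {e : (S.split v hv).Edge} {y : S.OutEdge v} :
    (S.split v hv).src e = outVert hv y ↔ e = old hv y.1 (outEdge_ne hv y) := by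
  refine ⟨fun h => ?_, by rintro rfl; exact src_old_of_eq y.2⟩
  induction e using edge_cases with
  | h_old e he =>
    by_cases hsrc : S.src e = S.tgt v
    · rw [src_old_of_eq hsrc, outVert_inj] at h
      subst h
      rfl
    · simp [src_old_of_ne hsrc] at h
  | h_new x z => exact absurd h inVert_ne_outVert

theorem tgt_old_eq_src_old {e f : S.Edge} {he : e ≠ v} {hf : f ≠ v} :
    (S.split v hv).tgt (old hv e he) = (S.split v hv).src (old hv f hf) ↔ S.tgt e = S.src f := by
  by_cases h : S.src f = S.tgt v
  · rw [src_old_of_eq h, h]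
    refine iff_of_false (fun h_out => ?_) (hv.tgt_ne he)
    by_cases htgt : S.tgt e = S.src v
    · exact inVert_ne_outVert ((tgt_old_of_eq htgt).symm.trans h_out)
    · exact oldVert_ne_outVert ((tgt_old_of_ne htgt).symm.trans h_out)
  · rw [src_old_of_ne h, tgt_eq_oldVert, base_old]

theorem tgt_base_eq_src_base {e f : (S.split v hv).Edge}
    (h : (S.split v hv).tgt e = (S.split v hv).src f) : S.tgt (base e) = S.src (base f) := by
  induction f using edge_cases with
  | h_old f hf =>
    induction e using edge_cases with
    | h_old e he => exact tgt_old_eq_src_old.1 h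
    | h_new x y =>
      rw [src_eq_outVert.1 h.symm, base_old, y.2, base_new]
  | h_new x y =>
    rw [tgt_eq_inVert.1 h, base_old, x.2, base_new]

theorem linked_map_base {p : List (S.split v hv).Edge} (h : (S.split v hv).Linked p) :
    S.Linked (p.map base) := by
  rw [Linked, List.isChain_map]
  exact h.imp fun _ _ => tgt_base_eq_src_base

theorem isDistributing_inVert (x : S.InEdge v) : (S.split v hv).IsDistributing (inVert hv x) := by
  constructor
  · simp only [tgt_eq_inVert, Set.ofPred_eq_eq_singleton, Set.encard_singleton]
  · obtain ⟨y, z, hy, hz, hne⟩ := Set.one_lt_encard_iff.1 hv.2.2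
    refine Set.one_lt_encard_iff.2 ⟨new hv x ⟨y, hy⟩, new hv x ⟨z, hz⟩, rfl, rfl, ?_⟩
    simpa [new_inj] using hne

theorem isCollecting_outVert (y : S.OutEdge v) : (S.split v hv).IsCollecting (outVert hv y) := by
  constructor
  · obtain ⟨x, z, hx, hz, hne⟩ := Set.one_lt_encard_iff.1 hv.1.1
    refine Set.one_lt_encard_iff.2 ⟨new hv ⟨x, hx⟩ y, new hv ⟨z, hz⟩ y, rfl, rfl, ?_⟩
    simpa [new_inj] using hne
  · simp only [src_eq_outVert, Set.ofPred_eq_eq_singleton, Set.encard_singleton]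

theorem encard_preimage_base {s : Set S.Edge} (hs : v ∉ s) :
    (base (hv := hv) ⁻¹' s).encard = s.encard := by
  have hne : ∀ e ∈ s, e ≠ v := fun e he => ne_of_mem_of_not_mem he hs
  have hinj : Set.InjOn base (base (hv := hv) ⁻¹' s) := fun e he f _ hef =>
    (eq_old_of_base_eq rfl (hne _ he)).trans (eq_old_of_base_eq hef.symm (hne _ he)).symm
  have hsub : s ⊆ Set.range (base (hv := hv)) := fun e he => ⟨old hv e (hne e he), rfl⟩
  rw [← hinj.encard_image, Set.image_preimage_eq_of_subset hsub]

theorem encard_src_oldVert {x : S.Vert} {hx} :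
    {e | (S.split v hv).src e = oldVert hv x hx}.encard = {e | S.src e = x}.encard := by
  simp only [src_eq_oldVert]
  exact encard_preimage_base (s := {e | S.src e = x}) hx.1.symm

theorem encard_tgt_oldVert {x : S.Vert} {hx} :
    {e | (S.split v hv).tgt e = oldVert hv x hx}.encard = {e | S.tgt e = x}.encard := by
  simp only [tgt_eq_oldVert]
  exact encard_preimage_base (s := {e | S.tgt e = x}) hx.2.symm

theorem isDistributing_oldVert {x : S.Vert} {hx} :
    (S.split v hv).IsDistributing (oldVert hv x hx) ↔ S.IsDistributing x := by
  rw [IsDistributing, IsDistributing, encard_src_oldVert, encard_tgt_oldVert]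

theorem isCollecting_oldVert {x : S.Vert} {hx} :
    (S.split v hv).IsCollecting (oldVert hv x hx) ↔ S.IsCollecting x := by
  rw [IsCollecting, IsCollecting, encard_src_oldVert, encard_tgt_oldVert]

theorem vert_type (h : ∀ x, S.IsDistributing x ∨ S.IsCollecting x) (x : (S.split v hv).Vert) :
    (S.split v hv).IsDistributing x ∨ (S.split v hv).IsCollecting x := by
  induction x using vert_cases with
  | h_old x hx =>
    rw [isDistributing_oldVert, isCollecting_oldVert]
    exact h x
  | h_in x => exact .inl (isDistributing_inVert x)
  | h_out y => exact .inr (isCollecting_outVert y)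

section OldEdges

variable {e : S.Edge} {he : e ≠ v}

theorem isDistributing_src_old :
    (S.split v hv).IsDistributing ((S.split v hv).src (old hv e he)) ↔
      S.IsDistributing (S.src e) ∧ S.src e ≠ S.tgt v := by
  by_cases h : S.src e = S.tgt v
  · simp [src_old_of_eq h, h, (isCollecting_outVert (hv := hv) ⟨e, h⟩).not_isDistributing]
  · simp [src_old_of_ne h, h, isDistributing_oldVert]

theorem isCollecting_tgt_old :
    (S.split v hv).IsCollecting ((S.split v hv).tgt (old hv e he)) ↔
      S.IsCollecting (S.tgt e) ∧ S.tgt e ≠ S.src v := by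
  by_cases h : S.tgt e = S.src v
  · simp [tgt_old_of_eq h, h, (isDistributing_inVert (hv := hv) ⟨e, h⟩).not_isCollecting]
  · simp [tgt_old_of_ne h, h, isCollecting_oldVert]

theorem isCollecting_src_old :
    (S.split v hv).IsCollecting ((S.split v hv).src (old hv e he)) ↔
      S.IsCollecting (S.src e) ∨ S.src e = S.tgt v := by
  by_cases h : S.src e = S.tgt v
  · simp [src_old_of_eq h, h, isCollecting_outVert]
  · simp [src_old_of_ne h, h, isCollecting_oldVert]

theorem isDistributing_tgt_old :
    (S.split v hv).IsDistributing ((S.split v hv).tgt (old hv e he)) ↔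
      S.IsDistributing (S.tgt e) ∨ S.tgt e = S.src v := by
  by_cases h : S.tgt e = S.src v
  · simp [tgt_old_of_eq h, h, isDistributing_inVert]
  · simp [tgt_old_of_ne h, h, isDistributing_oldVert]

end OldEdges

theorem front_ne_nil (h : ∀ e, S.IsDistributing (S.src e) → S.front e ≠ [])
    (e : (S.split v hv).Edge) (he : (S.split v hv).IsDistributing ((S.split v hv).src e)) :
    (S.split v hv).front e ≠ [] := by
  induction e using edge_cases with
  | h_old e hne =>
    rw [isDistributing_src_old] at he
    rw [front_old_of_ne he.2]
    exact h e he.1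
  | h_new x y => exact h y.1 (isDistributing_src_outEdge hv y)

theorem back_ne_nil (h : ∀ e, S.IsCollecting (S.tgt e) → S.back e ≠ [])
    (e : (S.split v hv).Edge) (he : (S.split v hv).IsCollecting ((S.split v hv).tgt e)) :
    (S.split v hv).back e ≠ [] := by
  induction e using edge_cases with
  | h_old e hne =>
    rw [isCollecting_tgt_old] at he
    rw [back_old_of_ne he.2]
    exact h e he.1
  | h_new x y => exact h x.1 (isCollecting_tgt_inEdge hv x)

theorem front_head_inj (h : ∀ e f, S.IsDistributing (S.src e) → S.src e = S.src f →
      (S.front e).head? = (S.front f).head? → e = f)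
    (e f : (S.split v hv).Edge) (he : (S.split v hv).IsDistributing ((S.split v hv).src e))
    (hef : (S.split v hv).src e = (S.split v hv).src f)
    (hhead : ((S.split v hv).front e).head? = ((S.split v hv).front f).head?) : e = f := by
  have hf : (S.split v hv).IsDistributing ((S.split v hv).src f) := hef ▸ he
  induction e using edge_cases <;> induction f using edge_cases
  case h_old.h_old e _ f _ =>
    rw [isDistributing_src_old] at he hf
    rw [src_old_of_ne he.2, src_old_of_ne hf.2, oldVert_inj] at hef
    rw [front_old_of_ne he.2, front_old_of_ne hf.2] at hhead
    obtain rfl := h e f he.1 hef hhead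
    rfl
  case h_old.h_new =>
    rw [isDistributing_src_old] at he
    simp [src_old_of_ne he.2] at hef
  case h_new.h_old =>
    rw [isDistributing_src_old] at hf
    exact absurd hef.symm (by simp [src_old_of_ne hf.2])
  case h_new.h_new x y x' y' =>
    obtain rfl := inVert_inj.1 hef
    rw [Subtype.ext (h y.1 y'.1 (isDistributing_src_outEdge hv y) (y.2.trans y'.2.symm) hhead)]

theorem back_last_inj (h : ∀ e f, S.IsCollecting (S.tgt e) → S.tgt e = S.tgt f →
      (S.back e).getLast? = (S.back f).getLast? → e = f)
    (e f : (S.split v hv).Edge) (he : (S.split v hv).IsCollecting ((S.split v hv).tgt e))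
    (hef : (S.split v hv).tgt e = (S.split v hv).tgt f)
    (hlast : ((S.split v hv).back e).getLast? = ((S.split v hv).back f).getLast?) : e = f := by
  have hf : (S.split v hv).IsCollecting ((S.split v hv).tgt f) := hef ▸ he
  induction e using edge_cases <;> induction f using edge_cases
  case h_old.h_old e _ f _ =>
    rw [isCollecting_tgt_old] at he hf
    rw [tgt_old_of_ne he.2, tgt_old_of_ne hf.2, oldVert_inj] at hef
    rw [back_old_of_ne he.2, back_old_of_ne hf.2] at hlast
    obtain rfl := h e f he.1 hef hlast
    rfl
  case h_old.h_new =>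
    rw [isCollecting_tgt_old] at he
    simp [tgt_old_of_ne he.2] at hef
  case h_new.h_old =>
    rw [isCollecting_tgt_old] at hf
    exact absurd hef.symm (by simp [tgt_old_of_ne hf.2])
  case h_new.h_new x y x' y' =>
    obtain rfl := outVert_inj.1 hef
    rw [Subtype.ext (h x.1 x'.1 (isCollecting_tgt_inEdge hv x) (x.2.trans x'.2.symm) hlast)]

section SinglePaths

variable {e : S.Edge} {he : e ≠ v}

theorem innerFront_old_of_eq (h : S.src e = S.tgt v) :
    (S.split v hv).innerFront [old hv e he] = [] :=
  innerFront_singleton_of_not (by rw [isDistributing_src_old]; exact fun h_ne => h_ne.2 h)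

theorem innerFront_old_of_ne (h : S.src e ≠ S.tgt v) :
    (S.split v hv).innerFront [old hv e he] = S.innerFront [e] := by
  have hdist : (S.split v hv).IsDistributing ((S.split v hv).src (old hv e he)) ↔
      S.IsDistributing (S.src e) := isDistributing_src_old.trans (and_iff_left h)
  by_cases he_dist : S.IsDistributing (S.src e)
  · rw [innerFront_singleton_of_isDistributing (hdist.2 he_dist), front_old_of_ne h,
      innerFront_singleton_of_isDistributing he_dist]
  · rw [innerFront_singleton_of_not (mt hdist.1 he_dist), innerFront_singleton_of_not he_dist]

theorem innerBack_old_of_eq (h : S.tgt e = S.src v) :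
    (S.split v hv).innerBack [old hv e he] = [] :=
  innerBack_singleton_of_not (by rw [isCollecting_tgt_old]; exact fun h_ne => h_ne.2 h)

theorem innerBack_old_of_ne (h : S.tgt e ≠ S.src v) :
    (S.split v hv).innerBack [old hv e he] = S.innerBack [e] := by
  have hcoll : (S.split v hv).IsCollecting ((S.split v hv).tgt (old hv e he)) ↔
      S.IsCollecting (S.tgt e) := isCollecting_tgt_old.trans (and_iff_left h)
  by_cases he_coll : S.IsCollecting (S.tgt e)
  · rw [innerBack_singleton_of_isCollecting (hcoll.2 he_coll), back_old_of_ne h,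
      innerBack_singleton_of_isCollecting he_coll]
  · rw [innerBack_singleton_of_not (mt hcoll.1 he_coll), innerBack_singleton_of_not he_coll]

theorem innerFront_new (x : S.InEdge v) (y : S.OutEdge v) :
    (S.split v hv).innerFront [new hv x y] = S.front y.1 :=
  innerFront_singleton_of_isDistributing (isDistributing_inVert x)

theorem innerBack_new (x : S.InEdge v) (y : S.OutEdge v) :
    (S.split v hv).innerBack [new hv x y] = S.back x.1 :=
  innerBack_singleton_of_isCollecting (isCollecting_outVert y)

end SinglePaths

theorem innerFront_support (hv : S.IsSupportEdge v) : S.innerFront [v] = [] :=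
  innerFront_singleton_of_not hv.1.not_isDistributing

theorem innerBack_support (hv : S.IsSupportEdge v) : S.innerBack [v] = [] :=
  innerBack_singleton_of_not hv.2.not_isCollecting

/-- The letters of `y` are read one edge early in `S'`, on `v_{ij}` instead of `y`, hence the
assumptions that the path neither starts after nor ends with an edge `v_{ij}`. -/
theorem innerFront_map_base {e : S.Edge} {he : e ≠ v} {p : List (S.split v hv).Edge}
    (h : (S.split v hv).Linked (old hv e he :: p)) (hlast : ∀ f ∈ p.getLast?, base f ≠ v) :
    (S.split v hv).innerFront p = S.innerFront (p.map base) := by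
  induction p using List.twoStepInduction generalizing e with
  | nil => rfl
  | singleton f =>
    obtain ⟨f, hf, rfl⟩ : ∃ g hg, f = old hv g hg := ⟨_, hlast f rfl, eq_old_of_base_eq rfl _⟩
    have hef := tgt_base_eq_src_base (List.isChain_cons_cons.1 h).1
    exact innerFront_old_of_ne (hef ▸ hv.tgt_ne he)
  | cons_cons f g p ih_two ih_one =>
    obtain ⟨hef, hfp⟩ := List.isChain_cons_cons.1 h
    induction f using edge_cases with
    | h_old f hf =>
      have hsrc : S.src f ≠ S.tgt v := tgt_old_eq_src_old.1 hef ▸ hv.tgt_ne he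
      rw [innerFront_cons, innerFront_old_of_ne hsrc, ih_one g hfp (by simpa using hlast)]
      exact (innerFront_cons f _).symm
    | h_new x y =>
      obtain rfl := src_eq_outVert.1 (List.isChain_cons_cons.1 hfp).1.symm
      have hp : ∀ f ∈ p.getLast?, base f ≠ v := fun f hf =>
        hlast f (by simp [List.getLast?_cons, Option.mem_def.1 hf])
      rw [innerFront_cons, innerFront_cons (old _ _ _), innerFront_new, innerFront_old_of_eq y.2,
        List.nil_append, ih_two hfp.tail hp, List.map_cons, List.map_cons, base_new, base_old,
        innerFront_cons v, innerFront_support hv, innerFront_cons y.1,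
        innerFront_singleton_of_isDistributing (isDistributing_src_outEdge hv y), List.nil_append]

theorem innerBack_map_base {e : S.Edge} {he : e ≠ v} {p : List (S.split v hv).Edge}
    (h : (S.split v hv).Linked (p ++ [old hv e he])) (hfirst : ∀ f ∈ p.head?, base f ≠ v) :
    (S.split v hv).innerBack p = S.innerBack (p.map base) := by
  induction p using List.twoStepInduction with
  | nil => rfl
  | singleton f =>
    obtain ⟨f, hf, rfl⟩ : ∃ g hg, f = old hv g hg := ⟨_, hfirst f rfl, eq_old_of_base_eq rfl _⟩
    have hfe := tgt_base_eq_src_base (List.isChain_cons_cons.1 h).1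
    exact innerBack_old_of_ne (hfe ▸ hv.src_ne he)
  | cons_cons f g p ih_two ih_one =>
    obtain ⟨hfg, hgp⟩ := List.isChain_cons_cons.1 h
    induction g using edge_cases with
    | h_old g hg =>
      obtain ⟨f, hf, rfl⟩ : ∃ d hd, f = old hv d hd := ⟨_, hfirst f rfl, eq_old_of_base_eq rfl _⟩
      have htgt : S.tgt f ≠ S.src v := tgt_old_eq_src_old.1 hfg ▸ hv.src_ne hg
      rw [innerBack_cons, innerBack_old_of_ne htgt, ih_one _ hgp (by simpa using hg)]
      exact (innerBack_cons f _).symm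
    | h_new x y =>
      obtain rfl := tgt_eq_inVert.1 hfg
      have hp : ∀ f ∈ p.head?, base f ≠ v := by
        cases p with
        | nil => simp
        | cons d p =>
          obtain rfl := src_eq_outVert.1 (List.isChain_cons_cons.1 hgp).1.symm
          simpa using outEdge_ne hv y
      rw [innerBack_cons, innerBack_cons (new _ _ _), innerBack_new, innerBack_old_of_eq x.2,
        List.nil_append, ih_two hgp.tail hp, List.map_cons, List.map_cons, base_new, base_old,
        innerBack_cons x.1, innerBack_cons v, innerBack_support hv, List.nil_append,
        innerBack_singleton_of_isCollecting (isCollecting_tgt_inEdge hv x)]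

theorem exists_eq_cons_old {p : List (S.split v hv).Edge} (h : (S.split v hv).StartsCollecting p) :
    ∃ e he r, p = old hv e he :: r ∧ (S.IsCollecting (S.src e) ∨ S.src e = S.tgt v) := by
  obtain ⟨e, r, rfl⟩ := List.exists_cons_of_ne_nil h.ne_nil
  rw [startsCollecting_cons] at h
  induction e using edge_cases with
  | h_old e he => exact ⟨e, he, r, rfl, isCollecting_src_old.1 h⟩
  | h_new x y => exact absurd h (isDistributing_inVert x).not_isCollecting

theorem exists_eq_concat_old {p : List (S.split v hv).Edge}
    (h : (S.split v hv).EndsDistributing p) :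
    ∃ r e he, p = r ++ [old hv e he] ∧ (S.IsDistributing (S.tgt e) ∨ S.tgt e = S.src v) := by
  obtain ⟨r, e, rfl⟩ := (List.eq_nil_or_concat' p).resolve_left h.ne_nil
  rw [endsDistributing_concat] at h
  induction e using edge_cases with
  | h_old e he => exact ⟨r, e, he, rfl, isDistributing_tgt_old.1 h⟩
  | h_new x y => exact absurd h (isCollecting_outVert y).not_isDistributing

theorem base_ne_of_mem_head? {p : List (S.split v hv).Edge}
    (h : (S.split v hv).StartsCollecting p) : ∀ e ∈ p.head?, base e ≠ v := by
  obtain ⟨e, he, r, rfl, -⟩ := exists_eq_cons_old h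
  simpa using he

theorem base_ne_of_mem_getLast? {p : List (S.split v hv).Edge}
    (h : (S.split v hv).EndsDistributing p) : ∀ e ∈ p.getLast?, base e ≠ v := by
  obtain ⟨r, e, he, rfl, -⟩ := exists_eq_concat_old h
  simpa using he

open Classical in
/-- The edge `v` if the path starts in a vertex `B_j`. -/
noncomputable def lead (p : List (S.split v hv).Edge) : List S.Edge :=
  if ∃ e ∈ p.head?, S.src (base e) = S.tgt v then [v] else []

open Classical in
/-- The edge `v` if the path ends in a vertex `A_i`. -/
noncomputable def trail (p : List (S.split v hv).Edge) : List S.Edge :=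
  if ∃ e ∈ p.getLast?, S.tgt (base e) = S.src v then [v] else []

/-- The symmetric path of `S` that corresponds to a symmetric path of `S'`. -/
noncomputable def hat (p : List (S.split v hv).Edge) : List S.Edge :=
  lead p ++ p.map base ++ trail p

section Hat

variable {p : List (S.split v hv).Edge}

theorem lead_of_eq {e : (S.split v hv).Edge} (h : S.src (base e) = S.tgt v) :
    lead (e :: p) = [v] := if_pos ⟨e, rfl, h⟩

theorem lead_of_ne {e : (S.split v hv).Edge} (h : S.src (base e) ≠ S.tgt v) :
    lead (e :: p) = [] := if_neg (by simpa using h)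

theorem trail_of_eq {e : (S.split v hv).Edge} (h : S.tgt (base e) = S.src v) :
    trail (p ++ [e]) = [v] := if_pos ⟨e, by simp, h⟩

theorem trail_of_ne {e : (S.split v hv).Edge} (h : S.tgt (base e) ≠ S.src v) :
    trail (p ++ [e]) = [] := if_neg (by simpa using h)

theorem lead_eq (p : List (S.split v hv).Edge) : lead p = [v] ∨ lead p = [] := by
  classical exact ite_eq_or_eq _ _ _

theorem trail_eq (p : List (S.split v hv).Edge) : trail p = [v] ∨ trail p = [] := by
  classical exact ite_eq_or_eq _ _ _

theorem innerFront_trail (p : List (S.split v hv).Edge) : S.innerFront (trail p) = [] := by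
  rcases trail_eq p with h | h
  · rw [h, innerFront_support hv]
  · rw [h, innerFront_nil]

theorem innerBack_lead (p : List (S.split v hv).Edge) : S.innerBack (lead p) = [] := by
  rcases lead_eq p with h | h
  · rw [h, innerBack_support hv]
  · rw [h, innerBack_nil]

theorem linked_lead_append (h : (S.split v hv).Linked p) : S.Linked (lead p ++ p.map base) := by
  have h_base := linked_map_base h
  cases p with
  | nil => simp [lead]
  | cons e r =>
    by_cases he : S.src (base e) = S.tgt v
    · rw [lead_of_eq he]
      exact List.isChain_cons_cons.2 ⟨he.symm, h_base⟩
    · rwa [lead_of_ne he]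

theorem linked_hat (h : (S.split v hv).Linked p) : S.Linked (hat p) := by
  have h_lead := linked_lead_append h
  rcases List.eq_nil_or_concat' p with rfl | ⟨r, e, rfl⟩
  · simp [hat, lead, trail]
  · rw [hat]
    by_cases he : S.tgt (base e) = S.src v
    · rw [trail_of_eq he, List.map_append, List.map_singleton, ← List.append_assoc,
        List.append_assoc _ [_] [_]]
      rw [List.map_append, List.map_singleton, ← List.append_assoc] at h_lead
      exact List.isChain_split.2 ⟨h_lead, List.isChain_pair.2 he⟩
    · rwa [trail_of_ne he, List.append_nil]

theorem startsCollecting_hat (h : (S.split v hv).StartsCollecting p) :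
    S.StartsCollecting (hat p) := by
  obtain ⟨e, he, r, rfl, hcoll⟩ := exists_eq_cons_old h
  rw [hat, List.append_assoc]
  by_cases hsrc : S.src e = S.tgt v
  · rw [lead_of_eq hsrc]
    exact startsCollecting_cons.2 hv.1
  · rw [lead_of_ne hsrc]
    exact startsCollecting_cons.2 (hcoll.resolve_right hsrc)

theorem endsDistributing_hat (h : (S.split v hv).EndsDistributing p) :
    S.EndsDistributing (hat p) := by
  obtain ⟨r, e, he, rfl, hdist⟩ := exists_eq_concat_old h
  rw [hat]
  by_cases htgt : S.tgt e = S.src v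
  · rw [trail_of_eq htgt]
    exact endsDistributing_concat.2 hv.2
  · rw [trail_of_ne htgt, List.append_nil, List.map_append, List.map_singleton,
      ← List.append_assoc]
    exact endsDistributing_concat.2 (hdist.resolve_right htgt)

theorem isSymmetricPath_hat (h : (S.split v hv).IsSymmetricPath p) : S.IsSymmetricPath (hat p) :=
  isSymmetricPath_iff.2
    ⟨linked_hat h.linked, startsCollecting_hat h.2.1, endsDistributing_hat h.2.2⟩

theorem frontWord_hat (hp : (S.split v hv).IsSymmetricPath p) :
    S.frontWord (hat p) = (S.split v hv).frontWord p := by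
  have hlast := base_ne_of_mem_getLast? hp.2.2
  obtain ⟨e, he, r, rfl, -⟩ := exists_eq_cons_old hp.2.1
  have hr := innerFront_map_base hp.linked fun f hf =>
    hlast f (by simp [List.getLast?_cons, Option.mem_def.1 hf])
  rw [hat, frontWord_append (by simp), innerFront_trail, List.append_nil, frontWord_cons, hr]
  by_cases hsrc : S.src e = S.tgt v
  · have hdist : S.IsDistributing (S.src e) := hsrc ▸ hv.2
    rw [lead_of_eq hsrc, front_old_of_eq hsrc, List.singleton_append, frontWord_cons,
      List.map_cons, base_old, innerFront_cons_of_isDistributing hdist, List.append_assoc]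
  · rw [lead_of_ne hsrc, front_old_of_ne hsrc]
    rfl

theorem backWord_hat (hV : S.front v = S.back v) (hp : (S.split v hv).IsSymmetricPath p) :
    S.backWord (hat p) = (S.split v hv).backWord p := by
  have hfirst := base_ne_of_mem_head? hp.2.1
  obtain ⟨r, e, he, rfl, -⟩ := exists_eq_concat_old hp.2.2
  have hr := innerBack_map_base hp.linked fun f hf =>
    hfirst f (by simp [List.head?_append, Option.mem_def.1 hf])
  rw [hat, List.append_assoc, backWord_append _ (by simp), innerBack_lead, List.nil_append,
    backWord_concat, hr, List.map_append, List.map_singleton, base_old]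
  by_cases htgt : S.tgt e = S.src v
  · have hcoll : S.IsCollecting (S.tgt e) := htgt ▸ hv.1
    rw [trail_of_eq htgt, back_old_of_eq htgt, backWord_concat,
      innerBack_concat_of_isCollecting hcoll, hV, List.append_assoc]
  · rw [trail_of_ne htgt, back_old_of_ne htgt, List.append_nil, backWord_concat]

theorem innerBack_map_base_of_startsCollecting {a q : List (S.split v hv).Edge}
    (h : (S.split v hv).Linked (a ++ q)) (ha : ∀ f ∈ a.head?, base f ≠ v)
    (hq : (S.split v hv).StartsCollecting q) :
    (S.split v hv).innerBack a = S.innerBack (a.map base) := by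
  obtain ⟨e, he, r, rfl, -⟩ := exists_eq_cons_old hq
  rw [List.append_cons] at h
  exact innerBack_map_base h.left ha

end Hat

theorem eq_of_base_eq_of_neighbors {c e d c' e' d' : (S.split v hv).Edge}
    (hce : (S.split v hv).tgt c = (S.split v hv).src e)
    (hed : (S.split v hv).tgt e = (S.split v hv).src d)
    (hce' : (S.split v hv).tgt c' = (S.split v hv).src e')
    (hed' : (S.split v hv).tgt e' = (S.split v hv).src d')
    (hc : base c = base c') (he : base e = base e') (hd : base d = base d') : e = e' := by
  induction e using edge_cases with
  | h_old e hne => exact (eq_old_of_base_eq he.symm hne).symm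
  | h_new x y =>
    induction e' using edge_cases with
    | h_old e' hne => exact absurd he.symm hne
    | h_new x' y' =>
      rw [tgt_eq_inVert.1 hce, tgt_eq_inVert.1 hce'] at hc
      rw [src_eq_outVert.1 hed.symm, src_eq_outVert.1 hed'.symm] at hd
      exact new_inj.2 ⟨Subtype.ext hc, Subtype.ext hd⟩

theorem eq_of_map_base_eq {p q : List (S.split v hv).Edge}
    (hp : (S.split v hv).Linked p) (hq : (S.split v hv).Linked q)
    (h : p.map base = q.map base) (hfirst : ∀ f ∈ p.head?, base f ≠ v)
    (hlast : ∀ f ∈ p.getLast?, base f ≠ v) : p = q := by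
  have hlen : p.length = q.length := by simpa using congrArg List.length h
  have hbase : ∀ i (hi : i < p.length), base p[i] = base (q[i]'(hlen ▸ hi)) := fun i hi => by
    have h_get := List.getElem_of_eq h (i := i) (by simpa using hi)
    rwa [List.getElem_map, List.getElem_map] at h_get
  rw [Linked, List.isChain_iff_getElem] at hp hq
  refine List.ext_getElem hlen fun i hi hi' => ?_
  by_cases hv_i : base p[i] = v
  · obtain ⟨j, rfl⟩ : ∃ j, i = j + 1 := Nat.exists_eq_succ_of_ne_zero <| by
      rintro rfl
      exact hfirst p[0] (by simp [List.head?_eq_getElem?, hi]) hv_i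
    have hi_next : j + 1 + 1 < p.length := by
      by_contra h_end
      have hj : p.length - 1 = j + 1 := by omega
      exact hlast p[j + 1] (by simp [List.getLast?_eq_getElem?, hj, hi]) hv_i
    exact eq_of_base_eq_of_neighbors (hp j hi) (hp _ hi_next) (hq j hi') (hq _ (hlen ▸ hi_next))
      (hbase j (by omega)) (hbase _ hi) (hbase _ hi_next)
  · rw [eq_old_of_base_eq rfl hv_i, eq_old_of_base_eq (hbase i hi).symm hv_i]

theorem exists_map_base_eq (hv : S.IsSupportEdge v) {e : S.Edge} {r : List S.Edge} (he : e ≠ v)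
    (h : S.Linked (e :: r)) (hlast : ∀ f ∈ (e :: r).getLast?, f ≠ v) :
    ∃ p, (S.split v hv).Linked (old hv e he :: p) ∧ p.map base = r := by
  induction r using List.twoStepInduction generalizing e with
  | nil => exact ⟨[], List.isChain_singleton _, rfl⟩
  | singleton f =>
    have hf : f ≠ v := hlast f (by simp)
    exact ⟨[old hv f hf], .cons_cons (tgt_old_eq_src_old.2 h.rel) (.singleton _), rfl⟩
  | cons_cons f y r ih_two ih_one =>
    obtain ⟨hef, hfr⟩ := List.isChain_cons_cons.1 h
    have hlast_f : ∀ d ∈ (f :: y :: r).getLast?, d ≠ v := by simpa using hlast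
    by_cases hfv : f = v
    · subst hfv
      obtain ⟨hfy, hyr⟩ := List.isChain_cons_cons.1 hfr
      have hy : y ≠ f := outEdge_ne hv ⟨y, hfy.symm⟩
      obtain ⟨p, hp, rfl⟩ := ih_two hy hyr (by simpa using hlast)
      refine ⟨new hv ⟨e, hef⟩ ⟨y, hfy.symm⟩ :: old hv y hy :: p, ?_, rfl⟩
      exact .cons_cons (tgt_old_of_eq hef) (.cons_cons (src_old_of_eq hfy.symm).symm hp)
    · obtain ⟨p, hp, hpr⟩ := ih_one y hfv hfr hlast_f
      exact ⟨old hv f hfv :: p, .cons_cons (tgt_old_eq_src_old.2 hef) hp, by simp [hpr]⟩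

end split

end WordGraph

section Strip

variable {β : Type*} {L M N T X Z : List β}

theorem exists_eq_append_of_append_eq_left (h : L ++ M = X ++ N) (hLN : ∀ e ∈ N.head?, e ∉ L) :
    ∃ X', X = L ++ X' ∧ M = X' ++ N := by
  rcases List.append_eq_append_iff.1 h with hX | ⟨c, rfl, rfl⟩
  · exact hX
  · cases c with
    | nil => exact ⟨[], by simp⟩
    | cons e c => exact absurd (by simp) (hLN e rfl)

theorem exists_eq_append_of_append_eq_right (h : M ++ T = N ++ Z)
    (hNT : ∀ e ∈ N.getLast?, e ∉ T) : ∃ Z', Z = Z' ++ T ∧ M = N ++ Z' := by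
  rcases List.append_eq_append_iff.1 h with ⟨c, rfl, rfl⟩ | ⟨c, hM, hZ⟩
  · rcases List.eq_nil_or_concat' c with rfl | ⟨c, e, rfl⟩
    · exact ⟨[], by simp⟩
    · exact absurd (by simp) (hNT e (by simp))
  · exact ⟨c, hZ, hM⟩

end Strip

namespace WordGraph

open MultiDigraph

variable {α : Type w} {S : WordGraph.{u, w} α} {W : ℕ → α} {v : S.Edge}
  {hv : S.IsSupportEdge v}

theorem IsRauzyScheme.exists_eq_concat_of_innerBack_eq (hS : S.IsRauzyScheme W) {x f : S.Edge}
    (hx : S.IsCollecting (S.tgt x)) (hxf : S.tgt x = S.src f) {a : List S.Edge} {s : List α}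
    (ha : S.Linked (a ++ [f])) (h : S.innerBack a = s ++ S.back x) : ∃ a', a = a' ++ [x] := by
  rcases List.eq_nil_or_concat' a with rfl | ⟨a, e, rfl⟩
  · simp [hS.back_ne_nil x hx] at h
  · have hex : S.tgt e = S.tgt x := by
      rw [List.append_assoc] at ha
      rw [hxf, ha.tgt_eq_src]
    have he : S.IsCollecting (S.tgt e) := hex ▸ hx
    rw [innerBack_concat_of_isCollecting he] at h
    have hlast := congrArg List.getLast? h
    rw [List.getLast?_append_of_ne_nil _ (hS.back_ne_nil e he),
      List.getLast?_append_of_ne_nil _ (hS.back_ne_nil x hx)] at hlast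
    exact ⟨a, by rw [hS.back_last_inj e x he hex hlast]⟩

theorem IsRauzyScheme.exists_eq_cons_of_innerFront_eq (hS : S.IsRauzyScheme W) {y f : S.Edge}
    (hy : S.IsDistributing (S.src y)) (hfy : S.tgt f = S.src y) {b : List S.Edge} {t : List α}
    (hb : S.Linked (f :: b)) (h : S.innerFront b = S.front y ++ t) : ∃ b', b = y :: b' := by
  cases b with
  | nil => simp [hS.front_ne_nil y hy] at h
  | cons e b =>
    have hey : S.src e = S.src y := by rw [← hfy, (List.isChain_cons_cons.1 hb).1]
    have he : S.IsDistributing (S.src e) := hey ▸ hy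
    rw [innerFront_cons_of_isDistributing he] at h
    have hhead := congrArg List.head? h
    rw [List.head?_append_of_ne_nil _ (hS.front_ne_nil e he),
      List.head?_append_of_ne_nil _ (hS.front_ne_nil y hy)] at hhead
    exact ⟨b, by rw [hS.front_head_inj e y he hey hhead]⟩

theorem isGood_old {e : S.Edge} {he : e ≠ v} : S.IsGood W v hv (split.old hv e he) := trivial

namespace split

theorem eq_of_mem_lead {p : List (S.split v hv).Edge} {e : S.Edge} (he : e ∈ lead p) : e = v := by
  rcases lead_eq p with h | h
  · exact List.mem_singleton.1 (h ▸ he)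
  · simp [h] at he

theorem eq_of_mem_trail {p : List (S.split v hv).Edge} {e : S.Edge} (he : e ∈ trail p) :
    e = v := by
  rcases trail_eq p with h | h
  · exact List.mem_singleton.1 (h ▸ he)
  · simp [h] at he

theorem exists_eq_append_of_hat_eq {p q : List (S.split v hv).Edge}
    (hp : (S.split v hv).Linked p) (hq : (S.split v hv).Linked q) (hp_ne : p ≠ [])
    (hfirst : ∀ f ∈ p.head?, base f ≠ v) (hlast : ∀ f ∈ p.getLast?, base f ≠ v)
    {X Z : List S.Edge} (h : hat q = X ++ p.map base ++ Z) :
    ∃ a b, q = a ++ p ++ b ∧ X = lead q ++ a.map base ∧ Z = b.map base ++ trail q := by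
  obtain ⟨Z, rfl, hZ⟩ := exists_eq_append_of_append_eq_right h <| by
    rw [List.getLast?_append_of_ne_nil _ (by simpa using hp_ne), List.getLast?_map]
    rintro _ he h_mem
    obtain ⟨f, hf, rfl⟩ := Option.mem_map.1 he
    exact hlast f hf (eq_of_mem_trail h_mem)
  rw [List.append_assoc] at hZ
  obtain ⟨X, rfl, hX⟩ := exists_eq_append_of_append_eq_left hZ <| by
    rw [List.head?_append_of_ne_nil _ (by simpa using hp_ne), List.head?_map]
    rintro _ he h_mem
    obtain ⟨f, hf, rfl⟩ := Option.mem_map.1 he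
    exact hfirst f hf (eq_of_mem_lead h_mem)
  obtain ⟨a, c, rfl, rfl, hc⟩ := List.map_eq_append_iff.1 hX
  obtain ⟨m, b, rfl, hm, rfl⟩ := List.map_eq_append_iff.1 hc
  obtain rfl := eq_of_map_base_eq hp hq.right.left hm.symm hfirst hlast
  exact ⟨a, b, (List.append_assoc _ _ _).symm, rfl, rfl⟩

theorem frontWord_eq_backWord (hword : ∀ p, S.IsSymmetricPath p → S.frontWord p = S.backWord p)
    (p : List (S.split v hv).Edge) (hp : (S.split v hv).IsSymmetricPath p) :
    (S.split v hv).frontWord p = (S.split v hv).backWord p := by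
  have hV : S.front v = S.back v := by
    simpa [frontWord_singleton, backWord] using hword [v] (isSymmetricPath_singleton hv)
  rw [← frontWord_hat hp, ← backWord_hat hV hp, hword _ (isSymmetricPath_hat hp)]

theorem isSynchronized (hsync : S.IsSynchronized) : (S.split v hv).IsSynchronized := by
  intro p q hp hq s t hst
  rw [← frontWord_hat hp, ← frontWord_hat hq] at hst
  obtain ⟨a, b, hab, ha⟩ := hsync _ _ (isSymmetricPath_hat hp) (isSymmetricPath_hat hq) s t hst
  obtain ⟨c, d, rfl, hc, -⟩ := exists_eq_append_of_hat_eq hp.linked hq.linked hp.ne_nil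
    (base_ne_of_mem_head? hp.2.1) (base_ne_of_mem_getLast? hp.2.2)
    (X := a ++ lead p) (Z := trail p ++ b) (by rw [hab, hat]; simp)
  refine ⟨c, d, rfl, ?_⟩
  have hc_first : ∀ f ∈ c.head?, base f ≠ v := fun f hf =>
    base_ne_of_mem_head? hq.2.1 f (by simp [List.head?_append, Option.mem_def.1 hf])
  have hword := congrArg S.innerBack hc
  rw [innerBack_append, innerBack_append, innerBack_lead, innerBack_lead, List.append_nil,
    List.nil_append, ha] at hword
  rw [innerBack_map_base_of_startsCollecting hq.linked.left hc_first hp.2.1, hword]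

theorem exists_eq_append_of_mem_new {p : List (S.split v hv).Edge}
    (hp : (S.split v hv).IsSymmetricPath p) {x : S.InEdge v} {y : S.OutEdge v}
    (h : new hv x y ∈ p) :
    ∃ a b, p = a ++ [old hv x.1 (inEdge_ne hv x), new hv x y,
      old hv y.1 (outEdge_ne hv y)] ++ b := by
  obtain ⟨a, b, rfl⟩ := List.append_of_mem h
  rcases List.eq_nil_or_concat' a with rfl | ⟨a, e, rfl⟩
  · exact absurd rfl (base_ne_of_mem_head? hp.2.1 (new hv x y) (by simp))
  rcases b with _ | ⟨f, b⟩
  · exact absurd rfl (base_ne_of_mem_getLast? hp.2.2 (new hv x y) (by simp))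
  rw [List.append_assoc] at hp
  have h_tail := List.isChain_cons_cons.1 (hp.linked.right)
  obtain rfl := tgt_eq_inVert.1 h_tail.1
  obtain rfl := src_eq_outVert.1 (List.isChain_cons_cons.1 h_tail.2).1.symm
  exact ⟨a, b, by simp⟩

theorem isGood_of_isSubword (hword : ∀ p, S.IsSymmetricPath p → S.frontWord p = S.backWord p)
    {p : List (S.split v hv).Edge} (hp : (S.split v hv).IsSymmetricPath p)
    (hsub : IsSubword ((S.split v hv).frontWord p) W) : ∀ e ∈ p, S.IsGood W v hv e := by
  intro e he
  induction e using edge_cases with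
  | h_old e he => exact isGood_old
  | h_new x y =>
    refine hsub.of_infix (u := S.back x.1 ++ S.front v ++ S.front y.1) ?_
    obtain ⟨a, b, hab⟩ := exists_eq_append_of_mem_new hp he
    have h_hat : hat p = (lead p ++ a.map base ++ [x.1]) ++ [v] ++
        (y.1 :: (b.map base ++ trail p)) := by
      rw [hat]
      nth_rw 2 [hab]
      simp
    have hp_hat := isSymmetricPath_hat hp
    rw [h_hat] at hp_hat
    rw [← frontWord_hat hp, h_hat,
      frontWord_append_append hword hp_hat (isSymmetricPath_singleton hv),
      innerBack_concat_of_isCollecting (isCollecting_tgt_inEdge hv x), frontWord_singleton,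
      innerFront_cons_of_isDistributing (isDistributing_src_outEdge hv y)]
    exact ⟨S.innerBack (lead p ++ a.map base), S.innerFront (b.map base ++ trail p), by simp⟩

theorem isForced_old {e : S.Edge} {he : e ≠ v} (hforced : S.IsForced W e) :
    (S.split v hv).IsForced W (old hv e he) := by
  obtain ⟨u, hu, hforce⟩ := hforced
  refine ⟨u, hu, fun p hp hup => ?_⟩
  rw [← frontWord_hat hp] at hup
  have h_mem := hforce _ (isSymmetricPath_hat hp) hup
  rw [hat, List.mem_append, List.mem_append] at h_mem
  rcases h_mem with (h_lead | h_map) | h_trail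
  · exact absurd (eq_of_mem_lead h_lead) he
  · obtain ⟨f, hf, hfe⟩ := List.mem_map.1 h_map
    rwa [eq_old_of_base_eq hfe he] at hf
  · exact absurd (eq_of_mem_trail h_trail) he

theorem isForced_new (hS : S.IsRauzyScheme W) (hsync : S.IsSynchronized) {x : S.InEdge v}
    {y : S.OutEdge v} (h_good : S.IsGood W v hv (new hv x y)) :
    (S.split v hv).IsForced W (new hv x y) := by
  refine ⟨_, h_good, fun p hp hup => ?_⟩
  obtain ⟨s, t, hst⟩ := hup
  have hp_hat := isSymmetricPath_hat hp
  have hv_path := isSymmetricPath_singleton hv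
  have h_word : S.frontWord (hat p) =
      s ++ S.back x.1 ++ S.frontWord [v] ++ (S.front y.1 ++ t) := by
    rw [frontWord_hat hp, ← hst, frontWord_singleton]
    simp
  obtain ⟨a, b, hab, ha⟩ := hsync [v] (hat p) hv_path hp_hat _ _ h_word
  have hb : S.innerFront b = S.front y.1 ++ t := by
    rw [hab] at hp_hat
    rw [hab, frontWord_append_append hS.front_eq_back hp_hat hv_path, ha] at h_word
    exact List.append_cancel_left h_word
  have h_linked : S.Linked (a ++ [v] ++ b) := hab ▸ hp_hat.linked
  obtain ⟨a, rfl⟩ := hS.exists_eq_concat_of_innerBack_eq (isCollecting_tgt_inEdge hv x) x.2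
    h_linked.left ha
  obtain ⟨b, rfl⟩ := hS.exists_eq_cons_of_innerFront_eq (isDistributing_src_outEdge hv y)
    y.2.symm (List.append_assoc _ [v] b ▸ h_linked).right hb
  obtain ⟨c, d, rfl, -⟩ := exists_eq_append_of_hat_eq
    (p := [old hv x.1 (inEdge_ne hv x), new hv x y, old hv y.1 (outEdge_ne hv y)])
    (.cons_cons (tgt_old_of_eq x.2) (.cons_cons (src_old_of_eq y.2).symm (.singleton _)))
    hp.linked (by simp) (by simpa using inEdge_ne hv x) (by simpa using outEdge_ne hv y)
    (X := a) (Z := b) (by rw [hab]; simp)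
  simp

theorem exists_hat_eq {r : List S.Edge} (h : S.IsSymmetricPath ([v] ++ r ++ [v])) :
    ∃ p, (S.split v hv).IsSymmetricPath p ∧ hat p = [v] ++ r ++ [v] := by
  have h_linked := h.linked
  cases r with
  | nil => exact absurd (List.isChain_pair.1 h_linked).symm (src_ne_tgt hv)
  | cons y r =>
    have hy : S.src y = S.tgt v := (List.isChain_cons_cons.1 h_linked).1.symm
    obtain ⟨r', x, hr'⟩ := (List.eq_nil_or_concat' (y :: r)).resolve_left (by simp)
    have hx : S.tgt x = S.src v := by
      rw [hr', List.append_assoc, List.append_assoc] at h_linked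
      exact h_linked.right.tgt_eq_src
    obtain ⟨p, hp, hpr⟩ := exists_map_base_eq hv (outEdge_ne hv ⟨y, hy⟩) h_linked.left.right
      (by simpa [hr'] using inEdge_ne hv ⟨x, hx⟩)
    have h_map : (old hv y (outEdge_ne hv ⟨y, hy⟩) :: p).map base = r' ++ [x] := by
      rw [← hr', ← hpr, List.map_cons, base_old]
    obtain ⟨q, l, hq, rfl, hl⟩ := List.map_eq_append_iff.1 h_map
    obtain ⟨f, rfl, hf⟩ := List.map_eq_singleton_iff.1 hl
    obtain rfl := eq_old_of_base_eq hf (inEdge_ne hv ⟨x, hx⟩)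
    refine ⟨_, isSymmetricPath_iff.2 ⟨hp, ?_, ?_⟩, ?_⟩
    · exact startsCollecting_cons.2 (isCollecting_src_old.2 (.inr hy))
    · rw [hq]
      exact endsDistributing_concat.2 (isDistributing_tgt_old.2 (.inr hx))
    · rw [hat, lead_of_eq hy, h_map, ← hr', hq, trail_of_eq hx]

theorem exists_cover_isSubword (hS : S.IsRauzyScheme W) (hrec : IsRecurrent W) {u : List α}
    (hu : IsSubword u W) : ∃ p, (S.split v hv).IsSymmetricPath p ∧
      u <:+: (S.split v hv).frontWord p ∧ IsSubword ((S.split v hv).frontWord p) W := by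
  have hV : IsSubword (S.frontWord [v]) W := frontWord_singleton v ▸ hS.front_subword v
  obtain ⟨r, hr, hur, hrw⟩ :=
    (hS.encodes hv).exists_cover_between hrec (isSymmetricPath_singleton hv) hV hu
  obtain ⟨p, hp, hpr⟩ := exists_hat_eq hr
  rw [← hpr, frontWord_hat hp] at hur hrw
  exact ⟨p, hp, hur, hrw⟩

theorem encodes (hS : S.IsRauzyScheme W) (hrec : IsRecurrent W) : (S.split v hv).Encodes W where
  isSynchronized := isSynchronized (hS.encodes hv).isSynchronized
  front_eq_back := frontWord_eq_backWord hS.front_eq_back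
  subword_covered u hu := by
    obtain ⟨p, hp, hup, -⟩ := exists_cover_isSubword hS hrec hu
    exact ⟨p, hp, hup⟩
  exists_isSubword := by
    obtain ⟨p, hp, -, hpw⟩ := exists_cover_isSubword hS hrec isSubword_nil
    exact ⟨p, hp, hpw⟩

end split

end WordGraph

/-! ### Contraction along vanishing vertices -/

namespace MultiDigraph

variable {H : MultiDigraph.{u}} {good : H.Edge → Prop}

theorem eq_of_not_isNonvanishing {e f : H.Edge} (h : ¬ H.IsNonvanishing good (H.src e))
    (he : good e) (hf : good f) (hef : H.src f = H.src e) : f = e := by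
  by_contra hne
  exact h (.inl (Set.one_lt_encard_iff.2 ⟨f, e, ⟨hf, hef⟩, ⟨he, rfl⟩, hne⟩))

theorem isNonvanishing_reverse {x : H.Vert} :
    H.reverse.IsNonvanishing good x ↔ H.IsNonvanishing good x := or_comm

/-- No intermediate vertex of the path `p` is non-vanishing. It is stated by splitting `p` at a pair
of consecutive edges, so that it can be transported along factorizations of paths. -/
def InnerVanishing (H : MultiDigraph.{u}) (good : H.Edge → Prop) (p : List H.Edge) : Prop :=
  ∀ a f g b, p = a ++ f :: g :: b → ¬ H.IsNonvanishing good (H.tgt f)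

theorem innerVanishing_singleton (e : H.Edge) : H.InnerVanishing good [e] := by
  rintro (_ | ⟨_, _ | ⟨_, _⟩⟩) f g b h <;> simp at h

theorem InnerVanishing.cons {e : H.Edge} {p : List H.Edge} (hp : H.InnerVanishing good p)
    (he : ¬ H.IsNonvanishing good (H.tgt e)) : H.InnerVanishing good (e :: p) := by
  rintro (_ | ⟨a, as⟩) f g b h
  · simp only [List.nil_append, List.cons.injEq] at h
    rwa [← h.1]
  · simp only [List.cons_append, List.cons.injEq] at h
    exact hp as f g b h.2

theorem InnerVanishing.of_mem_tail {e : H.Edge} {p : List H.Edge}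
    (hp : H.InnerVanishing good (e :: p)) (hl : H.Linked (e :: p)) {f : H.Edge} (hf : f ∈ p) :
    ¬ H.IsNonvanishing good (H.src f) := by
  obtain ⟨a, b, rfl⟩ := List.append_of_mem hf
  rcases List.eq_nil_or_concat' (e :: a) with h | ⟨c, g, h⟩
  · simp at h
  · have hsplit : e :: (a ++ f :: b) = c ++ g :: f :: b := by
      rw [← List.cons_append, h, List.append_assoc, List.singleton_append]
    rw [hsplit] at hl
    rw [← hl.tgt_eq_src]
    exact hp c g f b hsplit

theorem exists_prefix_innerVanishing {e : H.Edge} {r : List H.Edge}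
    (h : ∃ f ∈ (e :: r).getLast?, H.IsNonvanishing good (H.tgt f)) :
    ∃ p q, e :: r = p ++ q ∧ H.InnerVanishing good p ∧ p.head? = some e ∧
      ∃ f ∈ p.getLast?, H.IsNonvanishing good (H.tgt f) := by
  induction r generalizing e with
  | nil => exact ⟨[e], [], rfl, innerVanishing_singleton e, rfl, h⟩
  | cons g r ih =>
    by_cases he : H.IsNonvanishing good (H.tgt e)
    · exact ⟨[e], g :: r, rfl, innerVanishing_singleton e, rfl, e, rfl, he⟩
    · obtain ⟨p, q, hpq, hp, hh, hl⟩ := ih (e := g) (by simpa using h)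
      refine ⟨e :: p, q, by rw [hpq, List.cons_append], hp.cons he, rfl, ?_⟩
      cases p with
      | nil => simp at hh
      | cons x p => simpa using hl

/-- `K` is the contraction of `H` along good edges: `vert` identifies the vertices of `K` with the
non-vanishing vertices of `H`, and `chain` identifies its edges with the good paths between them
without non-vanishing intermediate vertices. -/
structure IsContraction (H : MultiDigraph.{u}) (good : H.Edge → Prop) (K : MultiDigraph.{u})
    (vert : K.Vert → H.Vert) (chain : K.Edge → List H.Edge) : Prop where
  vert_inj : Function.Injective vert
  vert_range : ∀ x, H.IsNonvanishing good x ↔ ∃ y, vert y = x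
  chain_linked : ∀ e, H.Linked (chain e)
  chain_good : ∀ e, ∀ f ∈ chain e, good f
  chain_head : ∀ e, ∃ f ∈ (chain e).head?, H.src f = vert (K.src e)
  chain_last : ∀ e, ∃ f ∈ (chain e).getLast?, H.tgt f = vert (K.tgt e)
  chain_inner : ∀ e, H.InnerVanishing good (chain e)
  chain_inj : Function.Injective chain
  chain_surj : ∀ p, H.Linked p → (∀ f ∈ p, good f) →
    (∃ f ∈ p.head?, H.IsNonvanishing good (H.src f)) →
    (∃ f ∈ p.getLast?, H.IsNonvanishing good (H.tgt f)) → H.InnerVanishing good p →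
    ∃ e, chain e = p

theorem innerVanishing_reverse {p : List H.Edge} (hl : H.Linked p)
    (h : H.InnerVanishing good p) : H.reverse.InnerVanishing good p.reverse := by
  intro a f g b hp
  have hsplit : p = b.reverse ++ g :: f :: a.reverse := by
    rw [← List.reverse_reverse p, hp]
    simp
  have hvanishing := h _ _ _ _ hsplit
  rw [hsplit] at hl
  rw [hl.tgt_eq_src] at hvanishing
  exact fun hf => hvanishing (isNonvanishing_reverse.1 hf)

namespace IsContraction

variable {K : MultiDigraph.{u}} {vert : K.Vert → H.Vert} {chain : K.Edge → List H.Edge}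

theorem reverse (hC : IsContraction H good K vert chain) :
    IsContraction H.reverse good K.reverse vert (List.reverse ∘ chain) where
  vert_inj := hC.vert_inj
  vert_range x := isNonvanishing_reverse.trans (hC.vert_range x)
  chain_linked e := linked_reverse.2 (hC.chain_linked e)
  chain_good e f hf := hC.chain_good e f (List.mem_reverse.1 hf)
  chain_head e := by
    simp only [Function.comp_apply, List.head?_reverse]
    exact hC.chain_last e
  chain_last e := by
    simp only [Function.comp_apply, List.getLast?_reverse]
    exact hC.chain_head e
  chain_inner e := innerVanishing_reverse (hC.chain_linked e) (hC.chain_inner e)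
  chain_inj e f h := hC.chain_inj (List.reverse_injective h)
  chain_surj p hl hg hh ht hi := by
    simp only [isNonvanishing_reverse] at hh ht
    obtain ⟨e, he⟩ := hC.chain_surj p.reverse (linked_reverse.2 hl)
      (fun f hf => hg f (List.mem_reverse.1 hf)) (by simpa using ht) (by simpa using hh)
      (innerVanishing_reverse hl hi)
    exact ⟨e, by simp [he]⟩

variable (hC : IsContraction H good K vert chain)
include hC

theorem isNonvanishing_vert (x : K.Vert) : H.IsNonvanishing good (vert x) :=
  (hC.vert_range _).2 ⟨x, rfl⟩

theorem chain_eq_cons (e : K.Edge) : ∃ f p, chain e = f :: p ∧ H.src f = vert (K.src e) := by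
  obtain ⟨f, hf, h⟩ := hC.chain_head e
  obtain ⟨p, hp⟩ := List.head?_eq_some_iff.1 hf
  exact ⟨f, p, hp, h⟩

theorem chain_ne_nil (e : K.Edge) : chain e ≠ [] := by
  obtain ⟨f, p, h, -⟩ := hC.chain_eq_cons e
  simp [h]

theorem not_isNonvanishing_of_mem_tail {e : K.Edge} {f g : H.Edge} {p : List H.Edge}
    (he : chain e = f :: p) (hg : g ∈ p) : ¬ H.IsNonvanishing good (H.src g) :=
  InnerVanishing.of_mem_tail (he ▸ hC.chain_inner e) (he ▸ hC.chain_linked e) hg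

theorem eq_of_head {e e' : K.Edge} {f : H.Edge} {p p' : List H.Edge} (he : chain e = f :: p)
    (he' : chain e' = f :: p') : e = e' := by
  wlog hle : p.length ≤ p'.length generalizing e e' p p'
  · exact (this he' he (Nat.le_of_not_le hle)).symm
  have hlinked : H.Linked (f :: p) := he ▸ hC.chain_linked e
  have hgood : ∀ g ∈ f :: p, good g := he ▸ hC.chain_good e
  have hlinked' : H.Linked (f :: p') := he' ▸ hC.chain_linked e'
  have hgood' : ∀ g ∈ f :: p', good g := he' ▸ hC.chain_good e'
  obtain ⟨c, rfl⟩ := hlinked.prefix_of_length_le (good := good) hlinked'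
    (fun x hx y hy hxy => eq_of_not_isNonvanishing (hC.not_isNonvanishing_of_mem_tail he hx)
      (hgood x (List.mem_cons_of_mem f hx)) hy hxy)
    (fun y hy => hgood' y (List.mem_cons_of_mem f hy)) hle
  cases c with
  | nil => exact hC.chain_inj (by rw [he, he', List.append_nil])
  | cons c cs =>
    obtain ⟨g, hg, hend⟩ := hC.chain_last e
    obtain ⟨r, hr⟩ := List.getLast?_eq_some_iff.1 hg
    refine absurd (hend ▸ hC.isNonvanishing_vert _) (hC.chain_inner e' r g c cs ?_)
    rw [he', ← List.cons_append, ← he, hr, List.append_assoc, List.singleton_append]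

theorem finite_edge [Finite H.Edge] : Finite K.Edge := by
  refine Finite.of_injective (fun e => (chain e).head (hC.chain_ne_nil e)) fun e e' hhead => ?_
  obtain ⟨f, p, hp, -⟩ := hC.chain_eq_cons e
  obtain ⟨f', p', hp', -⟩ := hC.chain_eq_cons e'
  obtain rfl : f = f' := by simpa [hp, hp'] using hhead
  exact hC.eq_of_head hp hp'

theorem prefix_of_flatMap_chain_prefix {p q : List K.Edge}
    (h : p.flatMap chain <+: q.flatMap chain) : p <+: q := by
  induction p generalizing q with
  | nil => exact List.nil_prefix
  | cons e p ih =>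
    obtain ⟨f, r, hf, -⟩ := hC.chain_eq_cons e
    rcases q with - | ⟨e', q⟩
    · simp [hf] at h
    · obtain ⟨f', r', hf', -⟩ := hC.chain_eq_cons e'
      rw [List.flatMap_cons, List.flatMap_cons] at h
      obtain rfl : f = f' := by
        rw [hf, hf', List.cons_append, List.cons_append, List.cons_prefix_cons] at h
        exact h.1
      obtain rfl := hC.eq_of_head hf hf'
      rw [List.prefix_append_right_inj] at h
      rw [List.prefix_cons_inj]
      exact ih h

theorem exists_eq_append_of_flatMap_chain_eq {q : List K.Edge} {f : H.Edge} {a b : List H.Edge}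
    (h : q.flatMap chain = a ++ f :: b) (hf : H.IsNonvanishing good (H.src f)) :
    ∃ q₁ q₂, q = q₁ ++ q₂ ∧ q₁.flatMap chain = a ∧ q₂.flatMap chain = f :: b := by
  induction q generalizing a with
  | nil => simp at h
  | cons e q ih =>
    rw [List.flatMap_cons, List.append_eq_append_iff] at h
    rcases h with ⟨a', rfl, h⟩ | ⟨c, hc, h⟩
    · obtain ⟨q₁, q₂, rfl, rfl, h₂⟩ := ih h
      exact ⟨e :: q₁, q₂, rfl, List.flatMap_cons, h₂⟩
    · rcases a with - | ⟨g, a⟩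
      · exact ⟨[], e :: q, rfl, rfl, by rw [List.flatMap_cons, hc, List.nil_append, h]⟩
      · rcases c with - | ⟨f', c⟩
        · obtain ⟨q₁, q₂, rfl, h₁, h₂⟩ := ih (a := []) h.symm
          exact ⟨e :: q₁, q₂, rfl, by simp [h₁, hc], h₂⟩
        · obtain ⟨rfl, -⟩ := List.cons.inj h
          refine absurd hf (hC.not_isNonvanishing_of_mem_tail hc ?_)
          exact List.mem_append_right a List.mem_cons_self

theorem head_expand {p : List K.Edge} {e : K.Edge} (h : p.head? = some e) :
    ∃ f ∈ (p.flatMap chain).head?, H.src f = vert (K.src e) := by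
  obtain ⟨p, rfl⟩ := List.head?_eq_some_iff.1 h
  obtain ⟨f, r, hf, hs⟩ := hC.chain_eq_cons e
  exact ⟨f, by simp [hf], hs⟩

theorem last_expand {p : List K.Edge} {e : K.Edge} (h : p.getLast? = some e) :
    ∃ f ∈ (p.flatMap chain).getLast?, H.tgt f = vert (K.tgt e) := by
  obtain ⟨p, rfl⟩ := List.getLast?_eq_some_iff.1 h
  obtain ⟨f, hf, hs⟩ := hC.chain_last e
  refine ⟨f, ?_, hs⟩
  rw [List.flatMap_append, List.flatMap_singleton,
    List.getLast?_append_of_ne_nil _ (hC.chain_ne_nil e)]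
  exact hf

theorem linked_expand {p : List K.Edge} (hp : K.Linked p) : H.Linked (p.flatMap chain) := by
  induction p with
  | nil => simp [Linked]
  | cons e p ih =>
    rw [List.flatMap_cons]
    refine List.isChain_append.2 ⟨hC.chain_linked e, ih hp.tail, fun f hf g hg => ?_⟩
    cases p with
    | nil => simp at hg
    | cons e' p =>
      obtain ⟨f', hf', hend⟩ := hC.chain_last e
      obtain ⟨g', hg', hstart⟩ := hC.head_expand (p := e' :: p) rfl
      obtain rfl := Option.mem_unique hf hf'
      obtain rfl := Option.mem_unique hg hg'
      rw [hend, hstart, (List.isChain_cons_cons.1 hp).1]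

theorem good_expand {p : List K.Edge} : ∀ f ∈ p.flatMap chain, good f := by
  intro f hf
  obtain ⟨e, -, he⟩ := List.mem_flatMap.1 hf
  exact hC.chain_good e f he

theorem exists_chain_append {q : List H.Edge} {x : K.Vert} (hl : H.Linked q)
    (hg : ∀ f ∈ q, good f) (hstart : ∃ f ∈ q.head?, H.src f = vert x)
    (hend : ∃ f ∈ q.getLast?, H.IsNonvanishing good (H.tgt f)) :
    ∃ e r, K.src e = x ∧ q = chain e ++ r := by
  obtain ⟨f, hf, hfx⟩ := hstart
  obtain ⟨q, rfl⟩ := List.head?_eq_some_iff.1 hf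
  obtain ⟨p, r, hpr, hinner, hhead, hlast⟩ := exists_prefix_innerVanishing hend
  rw [hpr] at hl hg
  obtain ⟨e, rfl⟩ := hC.chain_surj p hl.left (fun g hgp => hg g (List.mem_append_left r hgp))
    ⟨f, hhead, hfx ▸ hC.isNonvanishing_vert x⟩ hlast hinner
  obtain ⟨f', hf', hsrc⟩ := hC.chain_head e
  obtain rfl := Option.mem_unique hhead hf'
  exact ⟨e, r, hC.vert_inj (hsrc.symm.trans hfx), hpr⟩

theorem exists_expand_eq {q : List H.Edge} {x y : K.Vert} (hl : H.Linked q)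
    (hg : ∀ f ∈ q, good f) (hstart : ∃ f ∈ q.head?, H.src f = vert x)
    (hend : ∃ f ∈ q.getLast?, H.tgt f = vert y) :
    ∃ p, K.Linked p ∧ p.flatMap chain = q ∧ (∃ e ∈ p.head?, K.src e = x) ∧
      ∃ e ∈ p.getLast?, K.tgt e = y := by
  induction hn : q.length using Nat.strong_induction_on generalizing q x with
  | _ n ih =>
    obtain ⟨g, hgq, hgy⟩ := hend
    obtain ⟨e, r, hex, rfl⟩ := hC.exists_chain_append hl hg hstart
      ⟨g, hgq, hgy ▸ hC.isNonvanishing_vert y⟩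
    obtain ⟨f, hf, hfe⟩ := hC.chain_last e
    rcases r with - | ⟨c, r⟩
    · rw [List.append_nil] at hgq
      obtain rfl := Option.mem_unique hf hgq
      exact ⟨[e], List.isChain_singleton e, by simp, ⟨e, rfl, hex⟩, e, rfl,
        hC.vert_inj (hfe.symm.trans hgy)⟩
    · have hshorter : (c :: r).length < n := by
        rw [← hn, List.length_append]
        exact Nat.lt_add_of_pos_left (List.length_pos_iff.2 (hC.chain_ne_nil e))
      have hc : H.src c = vert (K.tgt e) :=
        ((List.isChain_append.1 hl).2.2 f hf c rfl).symm.trans hfe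
      rw [List.getLast?_append_of_ne_nil _ (List.cons_ne_nil c r)] at hgq
      obtain ⟨p, hp, hpr, ⟨e', he', hs⟩, ht⟩ := ih _ hshorter hl.right
        (fun h hh => hg h (List.mem_append_right _ hh)) ⟨c, rfl, hc⟩ ⟨g, hgq, hgy⟩ rfl
      obtain ⟨p, rfl⟩ := List.head?_eq_some_iff.1 he'
      exact ⟨e :: e' :: p, List.isChain_cons_cons.2 ⟨hs.symm, hp⟩,
        by rw [List.flatMap_cons, hpr], ⟨e, rfl, hex⟩, by simpa using ht⟩

theorem encard_src (hsucc : ∀ e, good e → ∃ p, H.Linked (e :: p) ∧ (∀ f ∈ p, good f) ∧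
      ∃ f ∈ (e :: p).getLast?, H.IsNonvanishing good (H.tgt f)) (x : K.Vert) :
    {e | K.src e = x}.encard = {f | good f ∧ H.src f = vert x}.encard := by
  let firstEdge : K.Edge → H.Edge := fun e => (chain e).head (hC.chain_ne_nil e)
  have chain_eq : ∀ e, chain e = firstEdge e :: (chain e).tail := fun e => by simp [firstEdge]
  have hinj : Set.InjOn firstEdge {e | K.src e = x} := fun e _ e' _ h =>
    hC.eq_of_head (chain_eq e) (h ▸ chain_eq e')
  rw [← hinj.encard_image]
  congr 1
  ext f
  constructor
  · rintro ⟨e, rfl, rfl⟩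
    obtain ⟨f, p, hp, hs⟩ := hC.chain_eq_cons e
    obtain ⟨rfl, -⟩ := List.cons.inj ((chain_eq e).symm.trans hp)
    exact ⟨hC.chain_good e _ (by rw [hp]; exact List.mem_cons_self), hs⟩
  · rintro ⟨hf, hs⟩
    obtain ⟨p, hl, hg, hend⟩ := hsucc f hf
    obtain ⟨e, r, hex, her⟩ := hC.exists_chain_append (x := x) hl
      (List.forall_mem_cons.2 ⟨hf, hg⟩) ⟨f, rfl, hs⟩ hend
    rw [chain_eq, List.cons_append, List.cons.injEq] at her
    exact ⟨e, hex, her.1.symm⟩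

end IsContraction

section RightExtension

variable {K : MultiDigraph.{u}}

theorem isRightExtension_singleton {e : K.Edge} (he : K.IsDistributing (K.tgt e)) :
    K.IsRightExtension [e] [e] := by
  refine ⟨⟨⟨by simp, by simp⟩, List.prefix_rfl, by simpa using he⟩, fun q hq _ _ => ?_⟩
  simpa [Nat.one_le_iff_ne_zero] using hq.1

theorem IsRightExtension.eq_singleton {e : K.Edge} {p : List K.Edge}
    (h : K.IsRightExtension [e] p) (he : K.IsDistributing (K.tgt e)) : p = [e] := by
  obtain ⟨⟨⟨hne, hl⟩, ⟨r, rfl⟩, hend⟩, hmin⟩ := h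
  have hlength := hmin [e] ⟨by simp, by simp⟩ List.prefix_rfl (by simpa using he)
  cases r with
  | nil => rfl
  | cons f r => simp at hlength

theorem IsRightExtension.exists_cons {e : K.Edge} {p : List K.Edge}
    (h : K.IsRightExtension [e] p) (he : ¬ K.IsDistributing (K.tgt e)) :
    ∃ f r, K.tgt e = K.src f ∧ p = e :: r ∧ K.IsRightExtension [f] r := by
  obtain ⟨⟨⟨hne, hl⟩, ⟨r, rfl⟩, hend⟩, hmin⟩ := h
  cases r with
  | nil => exact absurd (by simpa using hend) he
  | cons f r =>
    obtain ⟨hef, hl⟩ := List.isChain_cons_cons.1 hl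
    refine ⟨f, f :: r, hef, rfl, ⟨⟨by simp, hl⟩, ⟨r, rfl⟩, by simpa using hend⟩, ?_⟩
    rintro q ⟨-, hq⟩ ⟨s, rfl⟩ hqe
    simpa using hmin (e :: f :: s) ⟨by simp, List.isChain_cons_cons.2 ⟨hef, hq⟩⟩ ⟨f :: s, rfl⟩
      (by simpa using hqe)

theorem IsRightExtension.cons (htype : ∀ x, K.IsDistributing x ∨ K.IsCollecting x)
    {e f : K.Edge} {p : List K.Edge} (h : K.IsRightExtension [f] p)
    (he : ¬ K.IsDistributing (K.tgt e)) (hef : K.tgt e = K.src f) :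
    K.IsRightExtension [e] (e :: p) := by
  obtain ⟨⟨⟨hne, hl⟩, ⟨r, rfl⟩, hend⟩, hmin⟩ := h
  refine ⟨⟨⟨by simp, List.isChain_cons_cons.2 ⟨hef, hl⟩⟩, ⟨f :: r, rfl⟩, by simpa using hend⟩,
    ?_⟩
  rintro q ⟨-, hq⟩ ⟨s, rfl⟩ hqe
  cases s with
  | nil => exact absurd (by simpa using hqe) he
  | cons g s =>
    obtain ⟨heg, hl'⟩ := List.isChain_cons_cons.1 hq
    obtain rfl : g = f := ((hef ▸ (htype (K.tgt e)).resolve_left he :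
      K.IsCollecting (K.src f))).eq_of_src (heg.symm.trans hef)
    simpa using hmin (g :: s) ⟨by simp, hl'⟩ ⟨s, rfl⟩ (by simpa using hqe)

theorem IsRightExtension.unique (htype : ∀ x, K.IsDistributing x ∨ K.IsCollecting x)
    {e : K.Edge} {p q : List K.Edge} (hp : K.IsRightExtension [e] p)
    (hq : K.IsRightExtension [e] q) : p = q := by
  induction p generalizing e q with
  | nil => exact absurd rfl hp.1.1.1
  | cons x p ih =>
    by_cases he : K.IsDistributing (K.tgt e)
    · rw [hp.eq_singleton he, hq.eq_singleton he]
    · obtain ⟨f, r, hf, hpr, hr⟩ := hp.exists_cons he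
      obtain ⟨g, s, hg, rfl, hs⟩ := hq.exists_cons he
      obtain rfl : g = f := ((hf ▸ (htype (K.tgt e)).resolve_left he :
        K.IsCollecting (K.src f))).eq_of_src (hg.symm.trans hf)
      obtain ⟨rfl, rfl⟩ := List.cons.inj hpr
      rw [ih hr hs]

theorem exists_isRightExtension (htype : ∀ x, K.IsDistributing x ∨ K.IsCollecting x)
    {e : K.Edge} {r : List K.Edge} (hl : K.Linked (e :: r)) (hend : K.EndsDistributing (e :: r)) :
    ∃ p, K.IsRightExtension [e] p := by
  induction r generalizing e with
  | nil => exact ⟨[e], isRightExtension_singleton (by simpa using hend)⟩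
  | cons f r ih =>
    by_cases he : K.IsDistributing (K.tgt e)
    · exact ⟨[e], isRightExtension_singleton he⟩
    · obtain ⟨hef, hl⟩ := List.isChain_cons_cons.1 hl
      obtain ⟨p, hp⟩ := ih hl (by simpa using hend)
      exact ⟨e :: p, hp.cons htype he hef⟩

theorem rightExtension_eq {e : K.Edge} {p : List K.Edge}
    (hunique : ∃! q, K.IsRightExtension [e] q) (hp : K.IsRightExtension [e] p) :
    K.rightExtension e = p :=
  (dif_pos hunique.exists).trans (hunique.unique hunique.exists.choose_spec hp)

theorem leftExtension_eq {e : K.Edge} {p : List K.Edge}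
    (hunique : ∃! q, K.IsLeftExtension [e] q) (hp : K.IsLeftExtension [e] p) :
    K.leftExtension e = p :=
  (dif_pos hunique.exists).trans (hunique.unique hunique.exists.choose_spec hp)

end RightExtension

end MultiDigraph

namespace MultiDigraph

/-- A vertex at which reading along good edges to the right is not determined. -/
def IsBranching (H : MultiDigraph.{u}) (good : H.Edge → Prop) (x : H.Vert) : Prop :=
  H.IsNonvanishing good x ∧ H.IsDistributing x

/-- The properties of the graph `S'` and its good edges on which the contraction relies: `H` is
finite with distributing and collecting vertices only, every vertex lies on a good edge, any two
good edges are joined by a good path, and not all vertices vanish. -/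
structure IsPruned (H : MultiDigraph.{u}) (good : H.Edge → Prop) : Prop where
  finite_vert : Finite H.Vert
  finite_edge : Finite H.Edge
  vert_type : ∀ x, H.IsDistributing x ∨ H.IsCollecting x
  incident : ∀ x, ∃ e, good e ∧ (H.src e = x ∨ H.tgt e = x)
  exists_linked : ∀ e f, good e → good f →
    ∃ m, H.Linked (e :: m ++ [f]) ∧ ∀ g ∈ e :: m ++ [f], good g
  exists_nonvanishing : ∃ x, H.IsNonvanishing good x

variable {H K : MultiDigraph.{u}} {good : H.Edge → Prop} {vert : K.Vert → H.Vert}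
  {chain : K.Edge → List H.Edge}

theorem eq_of_not_isBranching (htype : ∀ x, H.IsDistributing x ∨ H.IsCollecting x) {e f : H.Edge}
    (h : ¬ H.IsBranching good (H.src e)) (he : good e) (hf : good f) (hef : H.src f = H.src e) :
    f = e := by
  by_cases hd : H.IsDistributing (H.src e)
  · exact eq_of_not_isNonvanishing (fun hn => h ⟨hn, hd⟩) he hf hef
  · exact ((htype _).resolve_left hd).eq_of_src hef

theorem prefix_of_not_isBranching (htype : ∀ x, H.IsDistributing x ∨ H.IsCollecting x)
    {e : H.Edge} {p q : List H.Edge} (hp : H.Linked (e :: p)) (hq : H.Linked (e :: q))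
    (hp_good : ∀ f ∈ p, good f) (hq_good : ∀ f ∈ q, good f)
    (hdet : ∀ f ∈ p, ¬ H.IsBranching good (H.src f))
    (hend : ∃ f ∈ (e :: q).getLast?, H.IsBranching good (H.tgt f)) : p <+: q := by
  induction p generalizing e q with
  | nil => exact List.nil_prefix
  | cons f p ih =>
    obtain ⟨hef, hp⟩ := List.isChain_cons_cons.1 hp
    rw [List.forall_mem_cons] at hp_good hdet
    rcases q with - | ⟨g, q⟩
    · exact absurd (hef ▸ (by simpa using hend)) hdet.1
    · obtain ⟨heg, hq⟩ := List.isChain_cons_cons.1 hq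
      rw [List.forall_mem_cons] at hq_good
      obtain rfl := eq_of_not_isBranching htype hdet.1 hp_good.1 hq_good.1 (heg.symm.trans hef)
      rw [List.prefix_cons_inj]
      exact ih hp hq hp_good.2 hq_good.2 hdet.2 (by simpa using hend)

theorem Linked.reflTransGen {p : List H.Edge} (hp : H.Linked p) {e f : H.Edge}
    (he : p.head? = some e) (hf : p.getLast? = some f) :
    Relation.ReflTransGen H.Step (H.src e) (H.tgt f) := by
  induction p generalizing e with
  | nil => simp at he
  | cons g p ih =>
    obtain rfl : g = e := by simpa using he
    rcases p with - | ⟨g', p⟩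
    · obtain rfl : g = f := by simpa using hf
      exact .single ⟨g, rfl, rfl⟩
    · obtain ⟨hgg', hp⟩ := List.isChain_cons_cons.1 hp
      exact .head ⟨g, rfl, hgg'⟩ (ih hp rfl (by simpa using hf))

theorem IsStronglyConnected.isConnected (hH : H.IsStronglyConnected) [hne : Nonempty H.Vert] :
    H.IsConnected := by
  refine ⟨hne, fun x y => ?_⟩
  induction hH x y with
  | refl => exact .refl _
  | tail _ hstep ih => exact .trans _ _ _ ih (.rel _ _ hstep)

namespace IsPruned

theorem reverse (hP : IsPruned H good) : IsPruned H.reverse good where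
  finite_vert := hP.finite_vert
  finite_edge := hP.finite_edge
  vert_type x := by
    rw [isDistributing_reverse, isCollecting_reverse]
    exact (hP.vert_type x).symm
  incident x := by
    obtain ⟨e, he, h⟩ := hP.incident x
    exact ⟨e, he, h.symm⟩
  exists_linked e f he hf := by
    obtain ⟨m, hl, hg⟩ := hP.exists_linked f e hf he
    have hreverse : e :: m.reverse ++ [f] = (f :: m ++ [e]).reverse := by simp
    refine ⟨m.reverse, hreverse ▸ linked_reverse.2 hl, fun g h => hg g ?_⟩
    rwa [hreverse, List.mem_reverse] at h
  exists_nonvanishing := by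
    obtain ⟨x, hx⟩ := hP.exists_nonvanishing
    exact ⟨x, isNonvanishing_reverse.2 hx⟩

theorem exists_good_src (hP : IsPruned H good) (x : H.Vert) : ∃ e, good e ∧ H.src e = x := by
  obtain ⟨e, he, rfl | rfl⟩ := hP.incident x
  · exact ⟨e, he, rfl⟩
  · obtain ⟨m, hl, hg⟩ := hP.exists_linked e e he he
    obtain ⟨f, r, hr⟩ := List.exists_cons_of_ne_nil (l := m ++ [e]) (by simp)
    rw [List.cons_append, hr] at hl hg
    exact ⟨f, hg f (by simp), (List.isChain_cons_cons.1 hl).1.symm⟩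

theorem exists_good_tgt (hP : IsPruned H good) (x : H.Vert) : ∃ e, good e ∧ H.tgt e = x :=
  hP.reverse.exists_good_src x

/-- Otherwise every vertex is left by exactly one good edge. Then there are as many good edges as
vertices, so every vertex is also entered by exactly one good edge, and all vertices vanish. -/
theorem exists_isBranching (hP : IsPruned H good) : ∃ x, H.IsBranching good x := by
  by_contra! hcon
  have := hP.finite_vert
  have := hP.finite_edge
  let s : {e // good e} → H.Vert := fun e => H.src e.1
  let t : {e // good e} → H.Vert := fun e => H.tgt e.1
  have hs : s.Bijective := by
    refine ⟨fun e f hef => Subtype.ext ?_, fun x => ?_⟩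
    · exact eq_of_not_isBranching hP.vert_type (hcon _) f.2 e.2 hef
    · obtain ⟨e, he, rfl⟩ := hP.exists_good_src x
      exact ⟨⟨e, he⟩, rfl⟩
  have ht : t.Surjective := fun x => by
    obtain ⟨e, he, rfl⟩ := hP.exists_good_tgt x
    exact ⟨⟨e, he⟩, rfl⟩
  have ht_inj : t.Injective := (ht.bijective_of_nat_card_le (Nat.card_eq_of_bijective s hs).le).1
  obtain ⟨x, hx | hx⟩ := hP.exists_nonvanishing <;>
    obtain ⟨e, f, he, hf, hne⟩ := Set.one_lt_encard_iff.1 hx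
  · exact hne (congrArg Subtype.val (@hs.1 ⟨e, he.1⟩ ⟨f, hf.1⟩ (he.2.trans hf.2.symm)))
  · exact hne (congrArg Subtype.val (@ht_inj ⟨e, he.1⟩ ⟨f, hf.1⟩ (he.2.trans hf.2.symm)))

theorem exists_collecting (hP : IsPruned H good) :
    ∃ x, H.IsNonvanishing good x ∧ H.IsCollecting x := by
  obtain ⟨x, hx, hd⟩ := hP.reverse.exists_isBranching
  exact ⟨x, isNonvanishing_reverse.1 hx, isDistributing_reverse.1 hd⟩

theorem encard_src (hP : IsPruned H good) (hC : IsContraction H good K vert chain) (x : K.Vert) :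
    {e | K.src e = x}.encard = {f | good f ∧ H.src f = vert x}.encard := by
  refine hC.encard_src (fun e he => ?_) x
  obtain ⟨y, hy, -⟩ := hP.exists_isBranching
  obtain ⟨f, hf, rfl⟩ := hP.exists_good_tgt y
  obtain ⟨m, hl, hg⟩ := hP.exists_linked e f he hf
  exact ⟨m ++ [f], hl, fun g h => hg g (List.mem_cons_of_mem _ h), f,
    by rw [← List.cons_append]; exact List.getLast?_concat, hy⟩

theorem encard_tgt (hP : IsPruned H good) (hC : IsContraction H good K vert chain) (x : K.Vert) :
    {e | K.tgt e = x}.encard = {f | good f ∧ H.tgt f = vert x}.encard :=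
  hP.reverse.encard_src hC.reverse x

theorem isDistributing_of_vert (hP : IsPruned H good) (hC : IsContraction H good K vert chain)
    {x : K.Vert} (h : H.IsDistributing (vert x)) : K.IsDistributing x := by
  have hle : {f | good f ∧ H.tgt f = vert x}.encard ≤ 1 := by
    rw [← h.1]
    exact Set.encard_le_encard fun f hf => hf.2
  rw [IsDistributing, hP.encard_src hC, hP.encard_tgt hC]
  exact ⟨hle.antisymm (Set.one_le_encard_iff_nonempty.2 (hP.exists_good_tgt (vert x))),
    (hC.isNonvanishing_vert x).resolve_right (not_lt_of_ge hle)⟩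

theorem isCollecting_of_vert (hP : IsPruned H good) (hC : IsContraction H good K vert chain)
    {x : K.Vert} (h : H.IsCollecting (vert x)) : K.IsCollecting x :=
  isDistributing_reverse.1
    (hP.reverse.isDistributing_of_vert hC.reverse (x := x) (isDistributing_reverse.2 h))

theorem isDistributing_iff (hP : IsPruned H good) (hC : IsContraction H good K vert chain)
    {x : K.Vert} : K.IsDistributing x ↔ H.IsDistributing (vert x) := by
  refine ⟨fun h => ?_, hP.isDistributing_of_vert hC⟩
  by_contra hn
  exact h.not_isCollecting (hP.isCollecting_of_vert hC ((hP.vert_type _).resolve_left hn))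

theorem isCollecting_iff (hP : IsPruned H good) (hC : IsContraction H good K vert chain)
    {x : K.Vert} : K.IsCollecting x ↔ H.IsCollecting (vert x) := by
  refine ⟨fun h => ?_, hP.isCollecting_of_vert hC⟩
  by_contra hn
  exact h.not_isDistributing (hP.isDistributing_of_vert hC ((hP.vert_type _).resolve_right hn))

theorem contraction_vert_type (hP : IsPruned H good) (hC : IsContraction H good K vert chain)
    (x : K.Vert) : K.IsDistributing x ∨ K.IsCollecting x :=
  (hP.vert_type (vert x)).imp (hP.isDistributing_of_vert hC) (hP.isCollecting_of_vert hC)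

theorem endsDistributing_expand (hP : IsPruned H good) (hC : IsContraction H good K vert chain)
    {p : List K.Edge} : H.EndsDistributing (p.flatMap chain) ↔ K.EndsDistributing p := by
  rcases List.eq_nil_or_concat' p with rfl | ⟨p, e, rfl⟩
  · simp [EndsDistributing]
  · obtain ⟨f, hf, h⟩ := hC.last_expand (p := p ++ [e]) (e := e) List.getLast?_concat
    rw [endsDistributing_concat, hP.isDistributing_iff hC, ← h]
    refine ⟨?_, fun hd => ⟨f, hf, hd⟩⟩
    rintro ⟨f', hf', hd⟩
    rwa [Option.mem_unique hf hf']

theorem startsCollecting_expand (hP : IsPruned H good) (hC : IsContraction H good K vert chain)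
    {p : List K.Edge} : H.StartsCollecting (p.flatMap chain) ↔ K.StartsCollecting p := by
  rcases p with - | ⟨e, p⟩
  · simp [StartsCollecting]
  · obtain ⟨f, hf, h⟩ := hC.head_expand (p := e :: p) (e := e) rfl
    rw [startsCollecting_cons, hP.isCollecting_iff hC, ← h]
    refine ⟨?_, fun hc => ⟨f, hf, hc⟩⟩
    rintro ⟨f', hf', hc⟩
    rwa [Option.mem_unique hf hf']

theorem isSymmetricPath_expand (hP : IsPruned H good) (hC : IsContraction H good K vert chain)
    {p : List K.Edge} (hp : K.IsSymmetricPath p) : H.IsSymmetricPath (p.flatMap chain) :=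
  isSymmetricPath_iff.2 ⟨hC.linked_expand hp.linked, (hP.startsCollecting_expand hC).2 hp.2.1,
    (hP.endsDistributing_expand hC).2 hp.2.2⟩

theorem exists_isSymmetricPath_expand_eq (hP : IsPruned H good)
    (hC : IsContraction H good K vert chain) {q : List H.Edge} (hq : H.IsSymmetricPath q)
    (hg : ∀ f ∈ q, good f) (hstart : ∃ f ∈ q.head?, H.IsNonvanishing good (H.src f))
    (hend : ∃ f ∈ q.getLast?, H.IsNonvanishing good (H.tgt f)) :
    ∃ p, K.IsSymmetricPath p ∧ p.flatMap chain = q := by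
  obtain ⟨e, he, he_src⟩ := hstart
  obtain ⟨f, hf, hf_tgt⟩ := hend
  obtain ⟨x, hx⟩ := (hC.vert_range _).1 he_src
  obtain ⟨y, hy⟩ := (hC.vert_range _).1 hf_tgt
  obtain ⟨p, hp, rfl, -⟩ := hC.exists_expand_eq hq.linked hg ⟨e, he, hx.symm⟩ ⟨f, hf, hy.symm⟩
  exact ⟨p, isSymmetricPath_iff.2 ⟨hp, (hP.startsCollecting_expand hC).1 hq.2.1,
    (hP.endsDistributing_expand hC).1 hq.2.2⟩, rfl⟩

theorem exists_linked_contraction (hP : IsPruned H good)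
    (hC : IsContraction H good K vert chain) (x y : K.Vert) :
    ∃ p, K.Linked p ∧ (∃ e ∈ p.head?, K.src e = x) ∧ ∃ e ∈ p.getLast?, K.tgt e = y := by
  obtain ⟨e, he, hex⟩ := hP.exists_good_src (vert x)
  obtain ⟨f, hf, hfy⟩ := hP.exists_good_tgt (vert y)
  obtain ⟨m, hl, hg⟩ := hP.exists_linked e f he hf
  obtain ⟨p, hp, -, hends⟩ :=
    hC.exists_expand_eq hl hg ⟨e, rfl, hex⟩ ⟨f, List.getLast?_concat, hfy⟩
  exact ⟨p, hp, hends⟩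

theorem isStronglyConnected_contraction (hP : IsPruned H good)
    (hC : IsContraction H good K vert chain) : K.IsStronglyConnected := by
  intro x y
  obtain ⟨p, hp, ⟨e, he, rfl⟩, f, hf, rfl⟩ := hP.exists_linked_contraction hC x y
  exact hp.reflTransGen he hf

theorem nonempty_vert_contraction (hP : IsPruned H good)
    (hC : IsContraction H good K vert chain) : Nonempty K.Vert := by
  obtain ⟨x, hx⟩ := hP.exists_nonvanishing
  obtain ⟨y, -⟩ := (hC.vert_range x).1 hx
  exact ⟨y⟩

theorem nontrivial_edge_contraction (hP : IsPruned H good)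
    (hC : IsContraction H good K vert chain) : Nontrivial K.Edge := by
  obtain ⟨y⟩ := hP.nonempty_vert_contraction hC
  rcases hP.contraction_vert_type hC y with h | h
  · obtain ⟨e, f, -, -, hne⟩ := Set.one_lt_encard_iff.1 h.2
    exact ⟨e, f, hne⟩
  · obtain ⟨e, f, -, -, hne⟩ := Set.one_lt_encard_iff.1 h.1
    exact ⟨e, f, hne⟩

theorem existsUnique_rightExtension (hP : IsPruned H good)
    (hC : IsContraction H good K vert chain) (e : K.Edge) : ∃! p, K.IsRightExtension [e] p := by
  have htype := hP.contraction_vert_type hC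
  obtain ⟨x, hx, hxd⟩ := hP.exists_isBranching
  obtain ⟨y, rfl⟩ := (hC.vert_range x).1 hx
  obtain ⟨p, hp, ⟨f, hf, hef⟩, g, hg, rfl⟩ := hP.exists_linked_contraction hC (K.tgt e) y
  obtain ⟨p, rfl⟩ := List.head?_eq_some_iff.1 hf
  have hend : K.EndsDistributing (e :: f :: p) :=
    ⟨g, by simpa using hg, (hP.isDistributing_iff hC).2 hxd⟩
  obtain ⟨q, hq⟩ :=
    exists_isRightExtension htype (List.isChain_cons_cons.2 ⟨hef.symm, hp⟩) hend
  exact ⟨q, hq, fun r hr => hr.unique htype hq⟩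

theorem existsUnique_leftExtension (hP : IsPruned H good)
    (hC : IsContraction H good K vert chain) (e : K.Edge) : ∃! p, K.IsLeftExtension [e] p := by
  obtain ⟨p, hp, hunique⟩ := hP.reverse.existsUnique_rightExtension hC.reverse e
  refine ⟨p.reverse, ?_, fun q hq => ?_⟩
  · change K.IsLeftExtension [e] p.reverse
    rw [← isRightExtension_reverse, List.reverse_reverse]
    exact hp
  · replace hq := isRightExtension_reverse.2 hq
    rw [← hunique _ hq, List.reverse_reverse]

theorem not_isBranching_of_rightExtension (hP : IsPruned H good)
    (hC : IsContraction H good K vert chain) {e : K.Edge} {p : List K.Edge}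
    (hp : K.IsRightExtension [e] p) {f : H.Edge} {r : List H.Edge}
    (hr : p.flatMap chain = f :: r) : ∀ g ∈ r, ¬ H.IsBranching good (H.src g) := by
  induction p generalizing e f r with
  | nil => exact absurd rfl hp.1.1.1
  | cons x p ih =>
    intro g hg hbranch
    obtain ⟨h, s, hs, -⟩ := hC.chain_eq_cons e
    have not_mem_chain : g ∉ s := fun hgs => hC.not_isNonvanishing_of_mem_tail hs hgs hbranch.1
    by_cases he : K.IsDistributing (K.tgt e)
    · rw [hp.eq_singleton he, List.flatMap_singleton, hs] at hr
      obtain ⟨rfl, rfl⟩ := List.cons.inj hr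
      exact not_mem_chain hg
    · obtain ⟨e', q, hee', hpq, hq⟩ := hp.exists_cons he
      obtain ⟨rfl, rfl⟩ := List.cons.inj hpq
      rw [List.flatMap_cons, hs, List.cons_append, List.cons.injEq] at hr
      obtain ⟨rfl, rfl⟩ := hr
      obtain ⟨-, ⟨t, rfl⟩, -⟩ := hq.1
      obtain ⟨h', s', hs', hsrc⟩ := hC.chain_eq_cons e'
      have hexpand : ([e'] ++ t).flatMap chain = h' :: (s' ++ t.flatMap chain) := by simp [hs']
      rw [hexpand] at hg
      rcases List.mem_cons.1 ((List.mem_append.1 hg).resolve_left not_mem_chain) with rfl | hg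
      · exact he (hee' ▸ (hP.isDistributing_iff hC).2 (hsrc ▸ hbranch.2))
      · exact ih hq hexpand g hg hbranch

end IsPruned

end MultiDigraph

/-! ### Words on the contraction -/

namespace WordGraph

open MultiDigraph

variable {α : Type w} {H K : WordGraph.{u, w} α} {good : H.Edge → Prop} {L : Set (List α)}
  {vert : K.Vert → H.Vert} {chain : K.Edge → List H.Edge}

/-- The properties of the graph with words `S'` on which the contraction relies. The set `L` stands
for the subwords of `W`; a general set is allowed since the reversed words are not subwords of a
right-infinite word. -/
structure IsWordPruned (H : WordGraph.{u, w} α) (good : H.Edge → Prop) (L : Set (List α)) :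
    Prop extends IsPruned H.toMultiDigraph good where
  front_ne_nil : ∀ e, H.IsDistributing (H.src e) → H.front e ≠ []
  front_head_inj : ∀ e f, H.IsDistributing (H.src e) → H.src e = H.src f →
    (H.front e).head? = (H.front f).head? → e = f
  back_ne_nil : ∀ e, H.IsCollecting (H.tgt e) → H.back e ≠ []
  back_last_inj : ∀ e f, H.IsCollecting (H.tgt e) → H.tgt e = H.tgt f →
    (H.back e).getLast? = (H.back f).getLast? → e = f
  front_eq_back : ∀ p, H.IsSymmetricPath p → H.frontWord p = H.backWord p
  infix_mem : ∀ u t, u <:+: t → t ∈ L → u ∈ L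
  exists_symmetricPath : ∀ e f, good e → good f → ∃ a m b,
    H.IsSymmetricPath (a ++ e :: m ++ f :: b) ∧
    (∀ g ∈ a ++ e :: m ++ f :: b, good g) ∧ H.frontWord (a ++ e :: m ++ f :: b) ∈ L

theorem IsWordPruned.reverse (hP : IsWordPruned H good L) :
    IsWordPruned H.reverse good {u | u.reverse ∈ L} where
  toIsPruned := hP.toIsPruned.reverse
  front_ne_nil e he := by
    simpa using hP.back_ne_nil e (isDistributing_reverse.1 he)
  front_head_inj e f he hef h := by
    rw [List.head?_reverse, List.head?_reverse] at h
    exact hP.back_last_inj e f (isDistributing_reverse.1 he) hef h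
  back_ne_nil e he := by
    simpa using hP.front_ne_nil e (isCollecting_reverse.1 he)
  back_last_inj e f he hef h := by
    rw [List.getLast?_reverse, List.getLast?_reverse] at h
    exact hP.front_head_inj e f (isCollecting_reverse.1 he) hef h
  front_eq_back p hp := by
    rw [← List.reverse_reverse p] at hp ⊢
    rw [frontWord_reverse, backWord_reverse, hP.front_eq_back _ (isSymmetricPath_reverse.1 hp)]
  infix_mem u t hu ht := hP.infix_mem _ _ (List.reverse_infix.2 hu) ht
  exists_symmetricPath e f he hf := by
    obtain ⟨a, m, b, hs, hg, hw⟩ := hP.exists_symmetricPath f e hf he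
    have hreverse : b.reverse ++ e :: m.reverse ++ f :: a.reverse =
        (a ++ f :: m ++ e :: b).reverse := by simp
    refine ⟨b.reverse, m.reverse, a.reverse, ?_⟩
    rw [hreverse]
    refine ⟨isSymmetricPath_reverse.2 hs, fun g h => hg g (List.mem_reverse.1 h), ?_⟩
    rwa [frontWord_reverse, Set.mem_ofPred_eq, List.reverse_reverse, ← hP.front_eq_back _ hs]

theorem frontWord_infix (htype : ∀ x, H.IsDistributing x ∨ H.IsCollecting x)
    (hword : ∀ p, H.IsSymmetricPath p → H.frontWord p = H.backWord p) {a p b : List H.Edge}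
    (hs : H.IsSymmetricPath (a ++ p ++ b)) (hp : H.EndsDistributing p) :
    H.frontWord p <:+: H.frontWord (a ++ p ++ b) := by
  obtain ⟨e, p, rfl⟩ := List.exists_cons_of_ne_nil hp.ne_nil
  rcases htype (H.src e) with he | he
  · rw [frontWord_append (by simp)]
    refine List.IsInfix.trans ?_ (List.prefix_append _ _).isInfix
    rcases eq_or_ne a [] with rfl | ha
    · exact List.infix_rfl
    · rw [frontWord_append ha, frontWord_eq_innerFront he]
      exact (List.suffix_append _ _).isInfix
  · have hsym : H.IsSymmetricPath (e :: p) :=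
      isSymmetricPath_iff.2 ⟨hs.linked.left.right, startsCollecting_cons.2 he, hp⟩
    rw [frontWord_append_append hword hs hsym]
    exact List.infix_append _ _ _

/-- `K` is the contraction of `H` along good edges, as a graph with words: the words of an edge are
read in `H` along its natural extensions. -/
structure IsWordContraction (H : WordGraph.{u, w} α) (good : H.Edge → Prop)
    (K : WordGraph.{u, w} α) (vert : K.Vert → H.Vert) (chain : K.Edge → List H.Edge) : Prop extends
    IsContraction H.toMultiDigraph good K.toMultiDigraph vert chain where
  front_eq : ∀ e p, K.IsRightExtension [e] p → K.front e = H.frontWord (p.flatMap chain)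
  back_eq : ∀ e p, K.IsLeftExtension [e] p → K.back e = H.backWord (p.flatMap chain)

namespace IsWordContraction

theorem reverse (hC : IsWordContraction H good K vert chain) :
    IsWordContraction H.reverse good K.reverse vert (List.reverse ∘ chain) where
  toIsContraction := hC.toIsContraction.reverse
  front_eq e p hp := by
    replace hp : K.IsLeftExtension [e] p.reverse := by
      rw [← List.reverse_reverse p] at hp
      exact (isRightExtension_reverse (G := K.toMultiDigraph) (s := [e])).1 hp
    rw [← List.reverse_reverse p, ← List.reverse_flatMap, frontWord_reverse, ← hC.back_eq e _ hp]
  back_eq e p hp := by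
    replace hp : K.IsRightExtension [e] p.reverse := isRightExtension_reverse.2 hp
    rw [← List.reverse_reverse p, ← List.reverse_flatMap, backWord_reverse, ← hC.front_eq e _ hp]

variable (hC : IsWordContraction H good K vert chain) (hP : IsWordPruned H good L)
include hC hP

theorem exists_front_eq (e : K.Edge) : ∃ h s t, chain e = h :: s ∧ H.src h = vert (K.src e) ∧
    K.front e = H.front h ++ t := by
  obtain ⟨p, hp⟩ := (hP.existsUnique_rightExtension hC.toIsContraction e).exists
  obtain ⟨h, s, hs, hsrc⟩ := hC.chain_eq_cons e
  obtain ⟨-, ⟨r, rfl⟩, -⟩ := hp.1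
  refine ⟨h, s, H.innerFront (s ++ r.flatMap chain), hs, hsrc, ?_⟩
  rw [hC.front_eq e _ hp, ← frontWord_cons]
  simp [hs]

/-- The natural extension of `e` is `e` followed by that of `f`, so both front words end in the same
word `t`. -/
theorem exists_front_eq_append {e f : K.Edge} (he : ¬ K.IsDistributing (K.tgt e))
    (hef : K.tgt e = K.src f) : ∃ h s t, chain f = h :: s ∧ K.front f = H.front h ++ t ∧
      K.front e = H.frontWord (chain e) ++ t := by
  obtain ⟨p, hp⟩ := (hP.existsUnique_rightExtension hC.toIsContraction f).exists
  obtain ⟨h, s, hs, hsrc⟩ := hC.chain_eq_cons f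
  have h_not : ¬ H.IsDistributing (H.src h) := by
    rwa [hsrc, ← hP.isDistributing_iff hC.toIsContraction, ← hef]
  have h_front_e := hC.front_eq e _ (hp.cons (hP.contraction_vert_type hC.toIsContraction) he hef)
  obtain ⟨-, ⟨r, rfl⟩, -⟩ := hp.1
  have h_expand : ([f] ++ r).flatMap chain = h :: (s ++ r.flatMap chain) := by simp [hs]
  refine ⟨h, s, H.innerFront (s ++ r.flatMap chain), hs, ?_, ?_⟩
  · rw [hC.front_eq f _ hp, h_expand, frontWord_cons]
  · rw [h_front_e, List.flatMap_cons, frontWord_append (hC.chain_ne_nil e), h_expand,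
      innerFront_cons_of_not h_not]

theorem frontWord_eq {p : List K.Edge} (hl : K.Linked p) (hend : K.EndsDistributing p) :
    K.frontWord p = H.frontWord (p.flatMap chain) := by
  have hiff {x} := hP.isDistributing_iff hC.toIsContraction (x := x)
  induction p with
  | nil => rfl
  | cons e p ih =>
    rcases p with - | ⟨f, r⟩
    · have he : K.IsDistributing (K.tgt e) := by simpa using hend
      rw [frontWord_singleton, hC.front_eq e [e] (isRightExtension_singleton he)]
    · obtain ⟨hef, hl⟩ := List.isChain_cons_cons.1 hl
      replace ih := ih hl (by simpa using hend)
      rw [List.flatMap_cons, frontWord_append (hC.chain_ne_nil e), frontWord_cons]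
      by_cases he : K.IsDistributing (K.tgt e)
      · obtain ⟨h, s, hs, hsrc⟩ := hC.chain_eq_cons f
        have hf : K.IsDistributing (K.src f) := hef ▸ he
        have hh : H.IsDistributing (H.src h) := hsrc ▸ hiff.1 hf
        rw [List.flatMap_cons, hs, List.cons_append, frontWord_eq_innerFront hf,
          frontWord_eq_innerFront hh] at ih
        rw [hC.front_eq e [e] (isRightExtension_singleton he), List.flatMap_singleton, ih,
          List.flatMap_cons, hs, List.cons_append]
      · obtain ⟨h, s, t, hs, hf, he'⟩ := hC.exists_front_eq_append hP he hef
        obtain ⟨h', s', hs', hsrc⟩ := hC.chain_eq_cons f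
        obtain ⟨rfl, rfl⟩ := List.cons.inj (hs.symm.trans hs')
        have h_not : ¬ H.IsDistributing (H.src h) := by rwa [hsrc, ← hiff, ← hef]
        rw [List.flatMap_cons, hs, List.cons_append, frontWord_cons, frontWord_cons, hf,
          List.append_assoc, List.append_cancel_left_eq] at ih
        rw [he', innerFront_cons_of_not (hef ▸ he), List.append_assoc, ih, List.flatMap_cons, hs,
          List.cons_append, innerFront_cons_of_not h_not]

theorem backWord_eq {p : List K.Edge} (hl : K.Linked p) (hstart : K.StartsCollecting p) :
    K.backWord p = H.backWord (p.flatMap chain) := by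
  have h := hC.reverse.frontWord_eq hP.reverse (linked_reverse.2 hl)
    (endsDistributing_reverse.2 hstart)
  rw [← List.reverse_flatMap, frontWord_reverse, frontWord_reverse] at h
  exact List.reverse_injective h

theorem front_ne_nil (e : K.Edge) (he : K.IsDistributing (K.src e)) : K.front e ≠ [] := by
  obtain ⟨h, s, t, -, hsrc, hf⟩ := hC.exists_front_eq hP e
  rw [hP.isDistributing_iff hC.toIsContraction, ← hsrc] at he
  simp [hf, hP.front_ne_nil h he]

theorem front_head_inj (e f : K.Edge) (he : K.IsDistributing (K.src e)) (hef : K.src e = K.src f)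
    (hhead : (K.front e).head? = (K.front f).head?) : e = f := by
  obtain ⟨h, s, t, hs, hsrc, hf⟩ := hC.exists_front_eq hP e
  obtain ⟨h', s', t', hs', hsrc', hf'⟩ := hC.exists_front_eq hP f
  have hsrc_eq : H.src h = H.src h' := by rw [hsrc, hsrc', hef]
  rw [hP.isDistributing_iff hC.toIsContraction, ← hsrc] at he
  rw [hf, hf', List.head?_append_of_ne_nil _ (hP.front_ne_nil h he),
    List.head?_append_of_ne_nil _ (hP.front_ne_nil h' (hsrc_eq ▸ he))] at hhead
  obtain rfl := hP.front_head_inj h h' he hsrc_eq hhead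
  exact hC.eq_of_head hs hs'

theorem back_ne_nil (e : K.Edge) (he : K.IsCollecting (K.tgt e)) : K.back e ≠ [] := by
  simpa using hC.reverse.front_ne_nil hP.reverse e (isDistributing_reverse.2 he)

theorem back_last_inj (e f : K.Edge) (he : K.IsCollecting (K.tgt e)) (hef : K.tgt e = K.tgt f)
    (hlast : (K.back e).getLast? = (K.back f).getLast?) : e = f :=
  hC.reverse.front_head_inj hP.reverse e f (isDistributing_reverse.2 he) hef
    (by rw [List.head?_reverse, List.head?_reverse, hlast])

/-- Past its first edge, the expanded natural extension of `e` never meets a branching vertex, so it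
is followed by every good path that reaches a branching vertex. -/
theorem front_mem (e : K.Edge) : K.front e ∈ L := by
  obtain ⟨p, hp⟩ := (hP.existsUnique_rightExtension hC.toIsContraction e).exists
  have hend := (hP.endsDistributing_expand hC.toIsContraction).2 hp.1.2.2
  have hlinked := hC.linked_expand hp.1.1.2
  have hgood := hC.good_expand (p := p)
  rw [hC.front_eq e p hp]
  obtain ⟨x, r, hexpand⟩ := List.exists_cons_of_ne_nil hend.ne_nil
  have hdet := hP.not_isBranching_of_rightExtension hC.toIsContraction hp hexpand
  rw [hexpand] at hlinked hgood hend ⊢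
  rw [List.forall_mem_cons] at hgood
  obtain ⟨y, hy⟩ := hP.exists_isBranching
  obtain ⟨f, hf, rfl⟩ := hP.exists_good_tgt y
  obtain ⟨a, m, b, hs, hg, hw⟩ := hP.exists_symmetricPath x f hgood.1 hf
  have hsplit : a ++ x :: m ++ f :: b = a ++ x :: (m ++ [f]) ++ b := by simp
  rw [hsplit] at hs hg hw
  have hprefix : r <+: m ++ [f] := prefix_of_not_isBranching hP.vert_type hlinked
    hs.linked.left.right hgood.2
    (fun g hgm => hg g (List.mem_append_left b (List.mem_append_right a (.tail x hgm)))) hdet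
    ⟨f, by rw [← List.cons_append]; exact List.getLast?_concat, hy⟩
  obtain ⟨c, hc⟩ := hprefix
  have hfactor : a ++ x :: (m ++ [f]) ++ b = a ++ x :: r ++ (c ++ b) := by simp [← hc]
  rw [hfactor] at hs hw
  exact hP.infix_mem _ _ (frontWord_infix hP.vert_type hP.front_eq_back hs hend) hw

theorem back_mem (e : K.Edge) : K.back e ∈ L := by
  have h : ((K.back e).reverse).reverse ∈ L := hC.reverse.front_mem hP.reverse e
  rwa [List.reverse_reverse] at h

theorem front_eq_back (p : List K.Edge) (hp : K.IsSymmetricPath p) :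
    K.frontWord p = K.backWord p := by
  rw [hC.frontWord_eq hP hp.linked hp.2.2, hC.backWord_eq hP hp.linked hp.2.1]
  exact hP.front_eq_back _ (hP.isSymmetricPath_expand hC.toIsContraction hp)

theorem innerBack_eq {a p : List K.Edge} (hl : K.Linked (a ++ p))
    (hstart : K.StartsCollecting (a ++ p)) (hp : K.StartsCollecting p) :
    K.innerBack a = H.innerBack (a.flatMap chain) := by
  rcases List.eq_nil_or_concat' a with rfl | ⟨a, z, rfl⟩
  · rfl
  · obtain ⟨f, p, rfl⟩ := List.exists_cons_of_ne_nil hp.ne_nil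
    have hz : K.IsCollecting (K.tgt z) := by
      rw [List.append_assoc, List.singleton_append] at hl
      exact hl.tgt_eq_src ▸ startsCollecting_cons.1 hp
    have hword := hC.backWord_eq hP hl.left ((startsCollecting_append (by simp)).1 hstart)
    obtain ⟨g, hg, hgz⟩ := hC.last_expand (p := a ++ [z]) List.getLast?_concat
    obtain ⟨c, hc⟩ := List.getLast?_eq_some_iff.1 hg
    have hg_collecting : H.IsCollecting (H.tgt g) :=
      hgz ▸ (hP.isCollecting_iff hC.toIsContraction).1 hz
    rwa [backWord_eq_innerBack hz, hc, backWord_eq_innerBack hg_collecting, ← hc] at hword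

theorem isSynchronized (hsync : H.IsSynchronized) : K.IsSynchronized := by
  intro p q hp hq s t hst
  rw [hC.frontWord_eq hP hp.linked hp.2.2, hC.frontWord_eq hP hq.linked hq.2.2] at hst
  obtain ⟨a, b, hab, ha⟩ := hsync _ _ (hP.isSymmetricPath_expand hC.toIsContraction hp)
    (hP.isSymmetricPath_expand hC.toIsContraction hq) s t hst
  obtain ⟨e, r, hr⟩ := List.exists_cons_of_ne_nil hp.ne_nil
  obtain ⟨f, hf, hfe⟩ := hC.head_expand (p := p) (e := e) (by rw [hr, List.head?_cons])
  obtain ⟨c, hc⟩ := List.head?_eq_some_iff.1 hf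
  rw [hc, List.append_assoc, List.cons_append] at hab
  obtain ⟨q₁, q₂, rfl, rfl, h₂⟩ :=
    hC.exists_eq_append_of_flatMap_chain_eq hab (hfe ▸ hC.isNonvanishing_vert _)
  obtain ⟨q₂, rfl⟩ : p <+: q₂ :=
    hC.prefix_of_flatMap_chain_prefix ⟨b, by rw [h₂, hc, List.cons_append]⟩
  refine ⟨q₁, q₂, (List.append_assoc ..).symm, ?_⟩
  rw [← ha]
  exact hC.innerBack_eq hP hq.linked hq.2.1 ((startsCollecting_append hp.ne_nil).2 hp.2.1)

theorem subword_covered {W : ℕ → α} (hH : H.Encodes W) (hrec : IsRecurrent W)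
    (hgood : ∀ p, H.IsSymmetricPath p → IsSubword (H.frontWord p) W → ∀ e ∈ p, good e)
    (hforced : ∀ e, good e → H.IsForced W e) {u : List α} (hu : IsSubword u W) :
    ∃ p, K.IsSymmetricPath p ∧ u <:+: K.frontWord p := by
  obtain ⟨c, hc, hc_collecting⟩ := hP.exists_collecting
  obtain ⟨d, hd, hd_distributing⟩ := hP.exists_isBranching
  obtain ⟨e, he, rfl⟩ := hP.exists_good_src c
  obtain ⟨f, hf, rfl⟩ := hP.exists_good_tgt d
  obtain ⟨a, m, p, n, b, hs, hw, hp, hup⟩ :=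
    hH.exists_path_through hrec (hforced e he) (hforced f hf) hu
  have hg := hgood _ hs hw
  have hsplit : a ++ e :: m ++ p ++ n ++ f :: b = a ++ ((e :: m) ++ p ++ (n ++ [f])) ++ b := by
    simp
  rw [hsplit] at hs hg
  have hsym : H.IsSymmetricPath ((e :: m) ++ p ++ (n ++ [f])) :=
    isSymmetricPath_of_append hs.linked.left.right (by simpa using hc_collecting)
      (by simpa using hd_distributing)
  obtain ⟨q, hq, hqe⟩ := hP.exists_isSymmetricPath_expand_eq hC.toIsContraction hsym
    (fun g hgm => hg g (List.mem_append_left _ (List.mem_append_right _ hgm)))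
    ⟨e, rfl, hc⟩ ⟨f, by rw [← List.append_assoc]; exact List.getLast?_concat, hd⟩
  refine ⟨q, hq, hup.trans ?_⟩
  rw [hC.frontWord_eq hP hq.linked hq.2.2, hqe, frontWord_append_append hP.front_eq_back hsym hp]
  exact List.infix_append _ _ _

theorem isForced {W : ℕ → α} {e : K.Edge} {f : H.Edge} {s : List H.Edge} (he : chain e = f :: s)
    (hforced : H.IsForced W f) : K.IsForced W e := by
  obtain ⟨u, hu, hmem⟩ := hforced
  refine ⟨u, hu, fun p hp hup => ?_⟩
  rw [hC.frontWord_eq hP hp.linked hp.2.2] at hup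
  obtain ⟨e', he', hf⟩ :=
    List.mem_flatMap.1 (hmem _ (hP.isSymmetricPath_expand hC.toIsContraction hp) hup)
  obtain ⟨f', s', hs', -⟩ := hC.chain_eq_cons e'
  rw [hs'] at hf
  rcases List.mem_cons.1 hf with rfl | hf
  · rwa [hC.eq_of_head he hs']
  · obtain ⟨g, r, hg, hsrc⟩ := hC.chain_eq_cons e
    obtain ⟨rfl, rfl⟩ := List.cons.inj (he.symm.trans hg)
    exact absurd (hsrc ▸ hC.isNonvanishing_vert _) (hC.not_isNonvanishing_of_mem_tail hs' hf)

end IsWordContraction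

theorem IsWordContraction.isRauzyScheme {W : ℕ → α} (hC : IsWordContraction H good K vert chain)
    (hP : IsWordPruned H good {u | IsSubword u W}) (hH : H.Encodes W) (hrec : IsRecurrent W)
    (hgood : ∀ p, H.IsSymmetricPath p → IsSubword (H.frontWord p) W → ∀ e ∈ p, good e)
    (hforced : ∀ e, good e → H.IsForced W e) : K.IsRauzyScheme W :=
  have := hP.nonempty_vert_contraction hC.toIsContraction
  have h_strong := hP.isStronglyConnected_contraction hC.toIsContraction
  { finite_vert := have := hP.finite_vert; Finite.of_injective vert hC.vert_inj
    finite_edge := have := hP.finite_edge; hC.finite_edge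
    connected := h_strong.isConnected
    vert_type := hP.contraction_vert_type hC.toIsContraction
    strongly_connected := h_strong
    more_than_one_edge := hP.nontrivial_edge_contraction hC.toIsContraction
    front_ne_nil := hC.front_ne_nil hP
    front_head_inj := hC.front_head_inj hP
    back_ne_nil := hC.back_ne_nil hP
    back_last_inj := hC.back_last_inj hP
    front_eq_back := hC.front_eq_back hP
    path_occurs := fun _ _ hp hq _ h =>
      (hC.isSynchronized hP hH.isSynchronized).path_occurs hp hq _ h
    front_subword := hC.front_mem hP
    back_subword := hC.back_mem hP
    subword_covered := fun _ hu => hC.subword_covered hP hH hrec hgood hforced hu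
    edge_forced := fun e => by
      obtain ⟨f, s, hs, -⟩ := hC.chain_eq_cons e
      exact hC.isForced hP hs (hforced f (hC.chain_good e f (by simp [hs]))) }

end WordGraph

/-! ### The elementary evolution as a contraction -/

namespace WordGraph

open MultiDigraph

variable {α : Type w} {S : WordGraph.{u, w} α} {v : S.Edge} {W : ℕ → α}

theorem exists_src_eq_of_vert_type (htype : ∀ x, S.IsDistributing x ∨ S.IsCollecting x)
    (x : S.Vert) : ∃ e, S.src e = x := by
  rcases htype x with h | h
  · obtain ⟨e, -, he, -⟩ := Set.one_lt_encard_iff.1 h.2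
    exact ⟨e, he⟩
  · obtain ⟨e, he⟩ := Set.encard_eq_one.1 h.2
    exact ⟨e, he.symm.subset (Set.mem_singleton e)⟩

namespace split

variable {hv : S.IsSupportEdge v}

theorem finite_vert [Finite S.Vert] [Finite S.Edge] : Finite (S.split v hv).Vert :=
  inferInstanceAs
    (Finite ({x : S.Vert // x ≠ S.src v ∧ x ≠ S.tgt v} ⊕ (S.InEdge v ⊕ S.OutEdge v)))

theorem finite_edge [Finite S.Edge] : Finite (S.split v hv).Edge :=
  inferInstanceAs (Finite ({e : S.Edge // e ≠ v} ⊕ (S.InEdge v × S.OutEdge v)))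

theorem isForced (hS : S.IsRauzyScheme W) {e : (S.split v hv).Edge} (he : S.IsGood W v hv e) :
    (S.split v hv).IsForced W e := by
  induction e using edge_cases with
  | h_old e _ => exact isForced_old (hS.edge_forced e)
  | h_new x y => exact isForced_new hS (hS.encodes hv).isSynchronized he

theorem exists_good_incident (W : ℕ → α) (htype : ∀ x, S.IsDistributing x ∨ S.IsCollecting x)
    (x : (S.split v hv).Vert) :
    ∃ e, S.IsGood W v hv e ∧ ((S.split v hv).src e = x ∨ (S.split v hv).tgt e = x) := by
  induction x using vert_cases with
  | h_old x hx =>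
    obtain ⟨e, rfl⟩ := exists_src_eq_of_vert_type htype x
    have he : e ≠ v := fun h => hx.1 (congrArg S.src h)
    exact ⟨old hv e he, isGood_old, .inl (src_old_of_ne hx.2)⟩
  | h_in x => exact ⟨old hv x.1 (inEdge_ne hv x), isGood_old, .inr (tgt_old_of_eq x.2)⟩
  | h_out y => exact ⟨old hv y.1 (outEdge_ne hv y), isGood_old, .inl (src_old_of_eq y.2)⟩

theorem exists_isNonvanishing (hS : S.IsRauzyScheme W) (hrec : IsRecurrent W)
    (hper : ¬ IsPeriodic W) : ∃ x, (S.split v hv).IsNonvanishing (S.IsGood W v hv) x := by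
  by_contra! h_vanishing
  refine hper ((encodes (hv := hv) hS hrec).isPeriodic_of_unique_good hrec
    (fun p hp hw => isGood_of_isSubword hS.front_eq_back hp hw) fun e f he hf hef => ?_)
  exact eq_of_not_isNonvanishing (h_vanishing _) hf he hef

theorem exists_good_symmetricPath (hS : S.IsRauzyScheme W) (hrec : IsRecurrent W)
    {e f : (S.split v hv).Edge} (he : S.IsGood W v hv e) (hf : S.IsGood W v hv f) :
    ∃ a m b, (S.split v hv).IsSymmetricPath (a ++ e :: m ++ f :: b) ∧
      (∀ g ∈ a ++ e :: m ++ f :: b, S.IsGood W v hv g) ∧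
      IsSubword ((S.split v hv).frontWord (a ++ e :: m ++ f :: b)) W := by
  obtain ⟨a, m, p, n, b, hs, hw, -⟩ :=
    (encodes hS hrec).exists_path_through hrec (isForced hS he) (isForced hS hf) isSubword_nil
  have hg := isGood_of_isSubword hS.front_eq_back hs hw
  refine ⟨a, m ++ p ++ n, b, ?_⟩
  simp only [List.append_assoc, List.cons_append] at hs hg hw ⊢
  exact ⟨hs, hg, hw⟩

theorem isPruned (hS : S.IsRauzyScheme W) (hrec : IsRecurrent W) (hper : ¬ IsPeriodic W) :
    IsPruned (S.split v hv).toMultiDigraph (S.IsGood W v hv) where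
  finite_vert := have := hS.finite_vert; have := hS.finite_edge; finite_vert
  finite_edge := have := hS.finite_edge; finite_edge
  vert_type := vert_type hS.vert_type
  incident := exists_good_incident W hS.vert_type
  exists_linked e f he hf := by
    obtain ⟨a, m, b, hs, hg, -⟩ := exists_good_symmetricPath hS hrec he hf
    have hsplit : a ++ e :: m ++ f :: b = a ++ (e :: m ++ [f]) ++ b := by simp
    rw [hsplit] at hs hg
    exact ⟨m, hs.linked.left.right,
      fun g h => hg g (List.mem_append_left _ (List.mem_append_right _ h))⟩
  exists_nonvanishing := exists_isNonvanishing hS hrec hper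

theorem isWordPruned (hS : S.IsRauzyScheme W) (hrec : IsRecurrent W) (hper : ¬ IsPeriodic W) :
    IsWordPruned (S.split v hv) (S.IsGood W v hv) {u | IsSubword u W} where
  toIsPruned := isPruned hS hrec hper
  front_ne_nil := front_ne_nil hS.front_ne_nil
  front_head_inj := front_head_inj hS.front_head_inj
  back_ne_nil := back_ne_nil hS.back_ne_nil
  back_last_inj := back_last_inj hS.back_last_inj
  front_eq_back := frontWord_eq_backWord hS.front_eq_back
  infix_mem _ _ hu ht := IsSubword.of_infix ht hu
  exists_symmetricPath _ _ := exists_good_symmetricPath hS hrec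

end split

theorem isContraction_evolutionGraph (W : ℕ → α) (hv : S.IsSupportEdge v) :
    IsContraction (S.split v hv).toMultiDigraph (S.IsGood W v hv) (S.evolutionGraph W v hv)
      Subtype.val GoodChain.path where
  vert_inj := Subtype.val_injective
  vert_range x := ⟨fun h => ⟨⟨x, h⟩, rfl⟩, by rintro ⟨y, rfl⟩; exact y.2⟩
  chain_linked e := e.isPath.2
  chain_good e := e.good_of_mem
  chain_head e := ⟨_, List.head?_eq_some_head e.isPath.1, rfl⟩
  chain_last e := ⟨_, List.getLast?_eq_some_getLast e.isPath.1, rfl⟩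
  chain_inner e a f g b h := e.inner_vanishing f (by simp [h])
  chain_inj := by
    rintro ⟨p, _⟩ ⟨q, _⟩ rfl
    rfl
  chain_surj p hl hg := by
    rintro ⟨f, hf, h_start⟩ ⟨g, hg_last, h_end⟩ h_inner
    have hne : p ≠ [] := by
      rintro rfl
      simp at hf
    refine ⟨⟨p, ⟨hne, hl⟩, hg, ?_, ?_, fun e he => ?_⟩, rfl⟩
    · rwa [List.head_of_mem_head? hf]
    · rwa [List.getLast_of_mem_getLast? hg_last]
    · obtain ⟨q, z, rfl⟩ := (List.eq_nil_or_concat' p).resolve_left hne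
      rw [List.dropLast_concat] at he
      obtain ⟨a, b, rfl⟩ := List.append_of_mem he
      obtain ⟨c, d, hcd⟩ := List.exists_cons_of_ne_nil (l := b ++ [z]) (by simp)
      exact h_inner a e c d (by rw [← hcd]; simp)

theorem isWordContraction_evolution (hv : S.IsSupportEdge v)
    (hP : IsPruned (S.split v hv).toMultiDigraph (S.IsGood W v hv)) :
    IsWordContraction (S.split v hv) (S.IsGood W v hv) (S.evolution W v hv)
      Subtype.val GoodChain.path where
  toIsContraction := isContraction_evolutionGraph W hv
  front_eq e p hp := by
    have h_unique := hP.existsUnique_rightExtension (isContraction_evolutionGraph W hv) e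
    change (S.split v hv).frontWord (S.expand ((S.evolutionGraph W v hv).rightExtension e)) = _
    rw [rightExtension_eq h_unique hp]
    rfl
  back_eq e p hp := by
    have h_unique := hP.existsUnique_leftExtension (isContraction_evolutionGraph W hv) e
    change (S.split v hv).backWord (S.expand ((S.evolutionGraph W v hv).leftExtension e)) = _
    rw [leftExtension_eq h_unique hp]
    rfl

end WordGraph

end RauzyEvolution

theorem mainTheorem3_general {α : Type*} (W : ℕ → α)
    (hrec : RauzyEvolution.IsRecurrent W) (hper : ¬ RauzyEvolution.IsPeriodic W)
    (S : RauzyEvolution.WordGraph α) (hS : S.IsRauzyScheme W)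
    (v : S.Edge) (hv : S.IsSupportEdge v) :
    (∀ e, ∃! p, (S.evolutionGraph W v hv).IsRightExtension [e] p) ∧
    (∀ e, ∃! p, (S.evolutionGraph W v hv).IsLeftExtension [e] p) ∧
    (S.evolution W v hv).IsRauzyScheme W := by
  open RauzyEvolution.WordGraph in
  have hP := split.isWordPruned (hv := hv) hS hrec hper
  have hC := isContraction_evolutionGraph W hv
  refine ⟨hP.existsUnique_rightExtension hC, hP.existsUnique_leftExtension hC, ?_⟩
  exact (isWordContraction_evolution hv hP.toIsPruned).isRauzyScheme hP (split.encodes hS hrec) hrec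
    (fun p hp hw => split.isGood_of_isSubword hS.front_eq_back hp hw)
    fun e he => split.isForced hS he

theorem mainTheorem3 {α : Type*} [Finite α] (W : ℕ → α)
    (hrec : RauzyEvolution.IsRecurrent W) (hper : ¬ RauzyEvolution.IsPeriodic W)
    (S : RauzyEvolution.WordGraph α) (hS : S.IsRauzyScheme W)
    (v : S.Edge) (hv : S.IsSupportEdge v) :
    (∀ e, ∃! p, (S.evolutionGraph W v hv).IsRightExtension [e] p) ∧
    (∀ e, ∃! p, (S.evolutionGraph W v hv).IsLeftExtension [e] p) ∧
    (S.evolution W v hv).IsRauzyScheme W :=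
  mainTheorem3_general W hrec hper S hS v hv
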